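/- Let $K$ be a field, $p\ge 2$, $a\ge 1$, $1\le b\le p$, $d\ge 1$ integers, $m_0=ap+b$ with $\gcd(m_0,d)=1$, and $m_i=m_0+id$ for $0\le i\le p$ (these integers then minimally generate the numerical semigroup $\sum_i\mathbb N m_i$). Let $R=K[X_1,\dots,X_p,X_0]$ and let $\wp$ be the kernel of the $K$-algebra map $R\to K[T]$, $X_i\mapsto T^{m_i}$. For integers $i,j\ge 0$ let $\epsilon(i,j)=i+j$, $\tau(i,j)=0$ if $i+j<p$, and $\epsilon(i,j)=\tau(i,j)=p$ if $i+j\ge p$. Put $$\phi(i,j)=X_iX_j-X_{\epsilon(i,j)}X_{i+j-\epsilon(i,j)}\ (1\le i\le j\le p-1),\qquad \psi(b,i)=X_{b+i}X_p^a-X_iX_0^{a+d}\ (0\le i\le p-b).$$ Let $\mathcal M$ be the free $R$-module on symbols $\Phi(i,j)$ ($1\le i\le j\le p-1$) and $\Psi(b,i)$ ($0\le i\le p-b$), and let $\mathcal N\subseteq\mathcal M$ be the kernel of the $R$-linear map $\mathcal M\to R$, $\Phi(i,j)\mapsto\phi(i,j)$, $\Psi(b,i)\mapsto\psi(b,i)$.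 Put $\Phi(i,j)=\Phi(j,i)$, and $\Phi(i,j)=0$ unless $i,j\in[1,p-1]$. Orders. Let $\omega(X^\alpha)=\sum_i\alpha_im_i$, and let $X^\alpha>_RX^\beta$ if $\omega(X^\alpha)>\omega(X^\beta)$, or $\omega(X^\alpha)=\omega(X^\beta)$ and the right-most nonzero entry of $(\alpha_1-\beta_1,\dots,\alpha_p-\beta_p,\alpha_0-\beta_0)$ is negative. Let $\varpi(X^\alpha\Psi(b,i))=X^\alpha X_p^aX_{b+i}$ and $\varpi(X^\alpha\Phi(i,j))=X^\alpha X_iX_j$. For monomials of $\mathcal M$ let $X^\alpha e>_{\mathcal M}X^{\alpha'}e'$ if $\varpi(X^\alpha e)>_R\varpi(X^{\alpha'}e')$, or these are equal and $e$ precedes $e'$ in the following sense: $\Psi(b,i)$ precedes $\Psi(b,j)$ if $i<j$; every $\Psi(b,i)$ precedes every $\Phi(l,j)$; and, for $i\le j$, $i'\le j'$, $\Phi(i,j)$ precedes $\Phi(i',j')$ if $j>j'$, or $j=j'$ and $i>i'$. Let $\widehat{\mathcal G}\subseteq\mathcal M$ be the set of the elements $$\begin{aligned}A(i;b,j)={}&X_i\Psi(b,j)-X_{b+i+j-\epsilon(i,b+j)}\Psi(b,\epsilon(i,b+j)-b)-X_p^a\Phi(i,b+j)\\&+X_0^{a+d}\bigl[\Phi(i,j)-\Phi(b+i+j-p,\,p-b)\bigr]\quad(1\le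 i\le p,\ 0\le j\le p-b-1),\\ B(i,j)={}&X_iX_j\Psi(b,p-b)-X_{\epsilon(i,j)}X_{i+j-\epsilon(i,j)}\Psi(b,p-b)-\psi(b,p-b)\Phi(i,j)\quad(1\le i,j\le p-1),\\ L(l;i,j)={}&X_l\Phi(i,j)-X_j\Phi(i,l)+X_{\tau(i,j)}\Phi(i+j-\tau(i,j),l)-X_{\tau(i,l)}\Phi(i+l-\tau(i,l),j)\\&(1\le l,i,j\le p-1,\ i\le j,\ l<j).\end{aligned}$$ Then the following hold. 1. The $\phi(i,j)$ and $\psi(b,i)$ generate $\wp$, so that $\mathcal N$ is the first syzygy module of $\wp$ (with respect to these generators); $>_{\mathcal M}$ is a monomial order on $\mathcal M$; and $\widehat{\mathcal G}$ is a minimal Gröbner basis of $\mathcal N$ with respect to $>_{\mathcal M}$. That is, $\widehat{\mathcal G}$ is a finite set of nonzero elements of $\mathcal N$ whose leading terms generate the submodule generated by the leading terms of all elements of $\mathcal N$, the leading coefficients of its elements are $1$, and no leading term of an element of $\widehat{\mathcal G}$ lies in the submodule generated by the leading terms of the other elements. 2. Let $\widehat R=R[\Psi,\Phi]$ be the polynomial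 ring over $R$ in the symbols above, identify $\mathcal M$ with the $R$-module of linear forms of $\widehat R$, and let $\varphi:\widehat R\to R[t]$ be the $R$-algebra map with $\Phi(i,j)\mapsto\phi(i,j)t$ and $\Psi(b,i)\mapsto\psi(b,i)t$. Then $\mathcal N$ is the set of linear forms in $\ker\varphi$, the ideal $\mathcal L\subseteq\widehat R$ generated by these forms is generated by $\widehat{\mathcal G}$, and the $R$-algebra map $\widehat R\to\operatorname{Sym}_R(\wp)$ that sends each symbol to the corresponding generator of $\wp$, viewed in degree one, is surjective with kernel $\mathcal L$. In particular $\operatorname{Sym}_R(\wp)\cong\widehat R/\mathcal L$. -/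

import Mathlib

/-! ### Monomial orders and Gröbner bases for submodules of a free module over `K[X_σ]` -/

namespace GroebnerModule

variable {σ ι K : Type*} [Field K]

/-- `gt` is a monomial order on the monomials `X^α e` (encoded as pairs `(α, e)`) of the free
module with basis `ι` over the polynomial ring in the variables `σ`: a strict total order that is
compatible with multiplication by monomials and is a well-ordering. -/
structure IsMonomialOrder (gt : (σ →₀ ℕ) × ι → (σ →₀ ℕ) × ι → Prop) : Prop where
  irrefl : ∀ s, ¬ gt s s
  trans : ∀ s t u, gt s t → gt t u → gt s u
  total : ∀ s t, s ≠ t → gt s t ∨ gt t s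
  mul_left : ∀ (γ : σ →₀ ℕ) (s t), gt s t → gt (γ + s.1, s.2) (γ + t.1, t.2)
  wf : WellFounded fun s t => gt t s

/-- The coefficient of the monomial `X^α e` in an element of the free module. -/
noncomputable def mcoeff (t : (σ →₀ ℕ) × ι) (H : ι →₀ MvPolynomial σ K) : K :=
  (H t.2).coeff t.1

/-- `t` is the leading monomial of `H`: it occurs in `H` and is greater than every other monomial
that occurs in `H`. -/
def IsLeadingMonomial (gt : (σ →₀ ℕ) × ι → (σ →₀ ℕ) × ι → Prop)
    (H : ι →₀ MvPolynomial σ K) (t : (σ →₀ ℕ) × ι) : Prop :=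
  mcoeff t H ≠ 0 ∧ ∀ s, mcoeff s H ≠ 0 → s ≠ t → gt t s

/-- The set of leading terms (leading coefficient times leading monomial) of the elements of `S`. -/
def leadingTerms (gt : (σ →₀ ℕ) × ι → (σ →₀ ℕ) × ι → Prop)
    (S : Set (ι →₀ MvPolynomial σ K)) : Set (ι →₀ MvPolynomial σ K) :=
  {f | ∃ H ∈ S, ∃ t, IsLeadingMonomial gt H t ∧
    f = Finsupp.single t.2 (MvPolynomial.monomial t.1 (mcoeff t H))}

/-- `G` is a Gröbner basis of the submodule `N`: a finite set of nonzero elements of `N` whose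
leading terms generate the submodule generated by all leading terms of `N`. -/
def IsGroebnerBasis (gt : (σ →₀ ℕ) × ι → (σ →₀ ℕ) × ι → Prop)
    (N : Submodule (MvPolynomial σ K) (ι →₀ MvPolynomial σ K))
    (G : Set (ι →₀ MvPolynomial σ K)) : Prop :=
  G.Finite ∧ G ⊆ N ∧ 0 ∉ G ∧
    Submodule.span (MvPolynomial σ K) (leadingTerms gt G) =
      Submodule.span (MvPolynomial σ K) (leadingTerms gt (N : Set (ι →₀ MvPolynomial σ K)))

/-- `G` is a minimal Gröbner basis of `N`: a Gröbner basis, all of whose leading coefficients are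
`1`, such that no leading term of an element `g` of `G` lies in the submodule generated by the
leading terms of the other elements of `G`. -/
def IsMinimalGroebnerBasis (gt : (σ →₀ ℕ) × ι → (σ →₀ ℕ) × ι → Prop)
    (N : Submodule (MvPolynomial σ K) (ι →₀ MvPolynomial σ K))
    (G : Set (ι →₀ MvPolynomial σ K)) : Prop :=
  IsGroebnerBasis gt N G ∧
    ∀ g ∈ G, ∃ t, IsLeadingMonomial gt g t ∧ mcoeff t g = 1 ∧
      (Finsupp.single t.2 (MvPolynomial.monomial t.1 (mcoeff t g)) : ι →₀ MvPolynomial σ K) ∉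
        Submodule.span (MvPolynomial σ K) (leadingTerms gt (G \ {g}))

end GroebnerModule

/-! ### The monomial curve of an arithmetic sequence -/

namespace MonomialCurve

/-- The arithmetic sequence `m_i = m_0 + i d`, where `m_0 = a p + b`. -/
def mseq (p a b d i : ℕ) : ℕ := a * p + b + i * d

/-- `R = K[X_1, …, X_p, X_0]`; the variable `X_i` has index `i : Fin (p + 1)`. -/
abbrev R (K : Type*) [Field K] (p : ℕ) : Type _ := MvPolynomial (Fin (p + 1)) K

/-- A natural number as an index of a variable (only used for `n ≤ p`). -/
def ix (p n : ℕ) : Fin (p + 1) := Fin.ofNat (p + 1) n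

/-- The variable `X_n` of `R`, for `n ≤ p`. -/
noncomputable def x (K : Type*) [Field K] (p n : ℕ) : R K p := MvPolynomial.X (ix p n)

/-- The parametrization `η : R → K[T]`, `X_i ↦ T ^ m_i`. -/
noncomputable def eta (K : Type*) [Field K] (p a b d : ℕ) : R K p →ₐ[K] Polynomial K :=
  MvPolynomial.aeval fun i => Polynomial.X ^ mseq p a b d i

/-- The defining ideal `℘` of the monomial curve. -/
noncomputable def curveIdeal (K : Type*) [Field K] (p a b d : ℕ) : Ideal (R K p) :=
  RingHom.ker (eta K p a b d)

/-- `ε(i, j)` is `i + j` if `i + j < p` and `p` otherwise. -/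
def eps (p i j : ℕ) : ℕ := if i + j < p then i + j else p

/-- `τ(i, j)` is `0` if `i + j < p` and `p` otherwise. -/
def tau (p i j : ℕ) : ℕ := if i + j < p then 0 else p

/-- `φ(i, j) = X_i X_j - X_{ε(i,j)} X_{i+j-ε(i,j)}`. -/
noncomputable def phiPoly (K : Type*) [Field K] (p i j : ℕ) : R K p :=
  x K p i * x K p j - x K p (eps p i j) * x K p (i + j - eps p i j)

/-- `ψ(b, i) = X_{b+i} X_p^a - X_i X_0^{a+d}`. -/
noncomputable def psiPoly (K : Type*) [Field K] (p a b d i : ℕ) : R K p :=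
  x K p (b + i) * x K p p ^ a - x K p i * x K p 0 ^ (a + d)

/-- The new indeterminates: `Ψ(b, i)` for `0 ≤ i ≤ p - b`, and `Φ(i, j)` for
`1 ≤ i ≤ j ≤ p - 1`. -/
inductive Gen (p b : ℕ) : Type
  | psi (i : ℕ) (hi : b + i ≤ p) : Gen p b
  | phi (i j : ℕ) (hi : 1 ≤ i) (hij : i ≤ j) (hj : j < p) : Gen p b

/-- The binomial of `R` that belongs to a new indeterminate. -/
noncomputable def binom (K : Type*) [Field K] (p a b d : ℕ) : Gen p b → R K p
  | .psi i _ => psiPoly K p a b d i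
  | .phi i j _ _ _ => phiPoly K p i j

theorem eta_x (K : Type*) [Field K] (p a b d n : ℕ) (hn : n ≤ p) :
    eta K p a b d (x K p n) = Polynomial.X ^ mseq p a b d n := by
  have h : ((ix p n : Fin (p + 1)) : ℕ) = n := by
    simp [ix, Fin.ofNat, Nat.mod_eq_of_lt (Nat.lt_succ_of_le hn)]
  simp [eta, x, h]

theorem binom_mem (K : Type*) [Field K] (p a b d : ℕ) (e : Gen p b) :
    binom K p a b d e ∈ curveIdeal K p a b d := by
  rw [curveIdeal, RingHom.mem_ker]
  cases e with
  | psi i hi =>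
    simp only [binom, psiPoly, map_sub, map_mul, map_pow]
    rw [eta_x _ _ _ _ _ _ hi, eta_x _ _ _ _ _ _ le_rfl, eta_x _ _ _ _ _ i (by omega),
      eta_x _ _ _ _ _ _ (Nat.zero_le p), ← pow_mul, ← pow_mul, ← pow_add, ← pow_add, sub_eq_zero]
    congr 1
    simp only [mseq]
    ring
  | phi i j hi hij hj =>
    have h1 : eps p i j ≤ p := by unfold eps; split_ifs <;> omega
    have h2 : i + j - eps p i j ≤ p := by unfold eps; split_ifs <;> omega
    have h3 : i + j = eps p i j + (i + j - eps p i j) := by unfold eps; split_ifs <;> omega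
    simp only [binom, phiPoly, map_sub, map_mul]
    rw [eta_x _ _ _ _ _ i (by omega), eta_x _ _ _ _ _ j (by omega), eta_x _ _ _ _ _ _ h1,
      eta_x _ _ _ _ _ _ h2, ← pow_add, ← pow_add, sub_eq_zero]
    congr 1
    simp only [mseq]
    generalize i + j - eps p i j = v at h3
    generalize eps p i j = u at h3
    calc a * p + b + i * d + (a * p + b + j * d) = 2 * (a * p + b) + (i + j) * d := by ring
      _ = a * p + b + u * d + (a * p + b + v * d) := by rw [h3]; ring

/-- The free `R`-module `𝓜` of linear forms in the new indeterminates. -/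
abbrev M (K : Type*) [Field K] (p b : ℕ) : Type _ := Gen p b →₀ R K p

/-- The first syzygy module `𝓝` of `℘`: the relations `∑ f_e e` in `𝓜` such that `∑ f_e g_e = 0`,
where `g_e` is the binomial that belongs to `e`. -/
noncomputable def syzygies (K : Type*) [Field K] (p a b d : ℕ) : Submodule (R K p) (M K p b) :=
  LinearMap.ker (Finsupp.linearCombination (R K p) (binom K p a b d))

/-! ### The monomial orders -/

/-- The weight `ω` of the monomial `X^α`. -/
def weight (p a b d : ℕ) (α : Fin (p + 1) →₀ ℕ) : ℕ := ∑ i, α i * mseq p a b d i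

/-- The position of the exponent of `X_i` in the tuple `(α_1, …, α_p, α_0)`. -/
def pos (p : ℕ) (i : Fin (p + 1)) : ℕ := if (i : ℕ) = 0 then p + 1 else i

/-- `X^α >_R X^β`: the weight is greater, or the weights agree and the right-most nonzero entry of
`(α_1 - β_1, …, α_p - β_p, α_0 - β_0)` is negative. -/
def gtR (p a b d : ℕ) (α β : Fin (p + 1) →₀ ℕ) : Prop :=
  weight p a b d β < weight p a b d α ∨
    (weight p a b d α = weight p a b d β ∧
      ∃ k, α k < β k ∧ ∀ l, pos p k < pos p l → α l = β l)

/-- The monomial `ϖ(X^α e)` of `R`: it is `X^α X_p^a X_{b+i}` for `e = Ψ(b, i)` and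
`X^α X_i X_j` for `e = Φ(i, j)`. -/
noncomputable def varpi (p a b : ℕ) : (Fin (p + 1) →₀ ℕ) × Gen p b → (Fin (p + 1) →₀ ℕ)
  | (α, .psi i _) => α + Finsupp.single (ix p p) a + Finsupp.single (ix p (b + i)) 1
  | (α, .phi i j _ _ _) => α + Finsupp.single (ix p i) 1 + Finsupp.single (ix p j) 1

/-- The order of the new indeterminates that breaks ties: `Ψ(b, i) > Ψ(b, j)` if `i < j`, every
`Ψ(b, i)` is greater than every `Φ(l, j)`, and `Φ(i, j) > Φ(i', j')` if `j > j'` or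
`j = j'` and `i > i'`. -/
def gtGen (p b : ℕ) : Gen p b → Gen p b → Prop
  | .psi i _, .psi j _ => i < j
  | .psi _ _, .phi _ _ _ _ _ => True
  | .phi _ _ _ _ _, .psi _ _ => False
  | .phi i j _ _ _, .phi i' j' _ _ _ => j' < j ∨ (j = j' ∧ i' < i)

/-- The order `>_𝓜` on the monomials of `𝓜`. -/
def gtM (p a b d : ℕ) (s t : (Fin (p + 1) →₀ ℕ) × Gen p b) : Prop :=
  gtR p a b d (varpi p a b s) (varpi p a b t) ∨
    (varpi p a b s = varpi p a b t ∧ gtGen p b s.2 t.2)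

/-! ### The set of relations -/

/-- `Ψ(b, i)` as an element of `𝓜`. -/
noncomputable def Psi (K : Type*) [Field K] (p b i : ℕ) : M K p b :=
  if h : b + i ≤ p then Finsupp.single (Gen.psi i h) 1 else 0

/-- `Φ(i, j)` as an element of `𝓜`, with the conventions `Φ(i, j) = Φ(j, i)`, and `Φ(i, j) = 0`
unless both indices lie in `[1, p - 1]`. (A negative index would also give `0`, so that truncated
subtraction in an index does no harm.) -/
noncomputable def Phi (K : Type*) [Field K] (p b i j : ℕ) : M K p b :=
  if h : 1 ≤ min i j ∧ max i j < p then
    Finsupp.single (Gen.phi (min i j) (max i j) h.1 min_le_max h.2) 1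
  else 0

/-- The relation `A(i; b, j)`. -/
noncomputable def relA (K : Type*) [Field K] (p a b d i j : ℕ) : M K p b :=
  x K p i • Psi K p b j
    - x K p (b + i + j - eps p i (b + j)) • Psi K p b (eps p i (b + j) - b)
    - x K p p ^ a • Phi K p b i (b + j)
    + x K p 0 ^ (a + d) • (Phi K p b i j - Phi K p b (b + i + j - p) (p - b))

/-- The relation `B(i, j)`. -/
noncomputable def relB (K : Type*) [Field K] (p a b d i j : ℕ) : M K p b :=
  (x K p i * x K p j) • Psi K p b (p - b)
    - (x K p (eps p i j) * x K p (i + j - eps p i j)) • Psi K p b (p - b)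
    - psiPoly K p a b d (p - b) • Phi K p b i j

/-- The relation `L(l; i, j)`. -/
noncomputable def relL (K : Type*) [Field K] (p b l i j : ℕ) : M K p b :=
  x K p l • Phi K p b i j
    - x K p j • Phi K p b i l
    + x K p (tau p i j) • Phi K p b (i + j - tau p i j) l
    - x K p (tau p i l) • Phi K p b (i + l - tau p i l) j

/-- The set `Ĝ` of relations. -/
def Ghat (K : Type*) [Field K] (p a b d : ℕ) : Set (M K p b) :=
  {H | ∃ i j, 1 ≤ i ∧ i ≤ p ∧ b + j < p ∧ H = relA K p a b d i j} ∪
  {H | ∃ i j, 1 ≤ i ∧ i < p ∧ 1 ≤ j ∧ j < p ∧ H = relB K p a b d i j} ∪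
  {H | ∃ l i j, 1 ≤ l ∧ 1 ≤ i ∧ i ≤ j ∧ l < j ∧ j < p ∧ H = relL K p b l i j}

/-! ### The symmetric algebra -/

/-- `R̂ = R[Ψ, Φ]`. -/
abbrev Rhat (K : Type*) [Field K] (p b : ℕ) : Type _ := MvPolynomial (Gen p b) (R K p)

/-- The element `∑ f_e e` of `𝓜` as a linear form in `R̂`. -/
noncomputable def linForm (K : Type*) [Field K] (p b : ℕ) : M K p b →ₗ[R K p] Rhat K p b :=
  Finsupp.linearCombination (R K p) fun e => (MvPolynomial.X e : Rhat K p b)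

/-- The `R`-algebra homomorphism `R̂ → R[t]` that sends each new indeterminate `e` to `g_e t`. -/
noncomputable def reesMap (K : Type*) [Field K] (p a b d : ℕ) :
    Rhat K p b →ₐ[R K p] Polynomial (R K p) :=
  MvPolynomial.aeval fun e => Polynomial.C (binom K p a b d e) * Polynomial.X

/-- The linear forms in the new indeterminates that lie in the kernel of `R̂ → R[t]`. -/
noncomputable def linearRelations (K : Type*) [Field K] (p a b d : ℕ) :
    Submodule (R K p) (Rhat K p b) :=
  MvPolynomial.homogeneousSubmodule (Gen p b) (R K p) 1 ⊓
    LinearMap.ker (reesMap K p a b d).toLinearMap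

/-- The ideal `𝓛` of `R̂` generated by the linear relations. -/
noncomputable def idealL (K : Type*) [Field K] (p a b d : ℕ) : Ideal (Rhat K p b) :=
  Ideal.span (linearRelations K p a b d : Set (Rhat K p b))

/-- The `R`-algebra homomorphism `R̂ → Sym_R(℘)` that sends each new indeterminate `e` to the
degree-one element `g_e ∈ ℘` of the symmetric algebra. -/
noncomputable def symMap (K : Type*) [Field K] (p a b d : ℕ) :
    Rhat K p b →ₐ[R K p] SymmetricAlgebra (R K p) (curveIdeal K p a b d) :=
  MvPolynomial.aeval fun e =>
    SymmetricAlgebra.ι (R K p) (curveIdeal K p a b d) ⟨binom K p a b d e, binom_mem K p a b d e⟩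

end MonomialCurve

/-! ### Division and minimality in free modules -/

namespace GroebnerModule

variable {σ ι K : Type*} [Field K] {gt : (σ →₀ ℕ) × ι → (σ →₀ ℕ) × ι → Prop}

/-! Each binomial `g_e` is monic for `>_R` (`gtR_leadExp_tailExp`), and `varpi` of `X^α e` is the
leading monomial of `X^α g_e`. So `>_𝓜` is a Schreyer order, but no S-pair has to be reduced.

Let a syzygy `∑ f_e g_e = 0` have leading monomial `t = X^α e`. At `varpi t` the tails contribute
nothing, because they come from strictly smaller products. The contribution of `t` can thus be
cancelled only by some `X^β f` with the same `varpi` and with `e` preceding `f`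
(`exists_varpi_eq_of_mem_syzygies`). Then `X^α` is a multiple of `lcm(in g_e, in g_f) / in g_e`.
Running through the pairs `(e, f)` shows that this quotient always has a factor that makes `t`
divisible by one of `X_i Ψ(b, j)` with `b + j < p`, `X_i X_j Ψ(b, p - b)`, or `X_l Φ(i, j)` with `l
< j` (`exists_leadingMonomial_dvd`). These are exactly the leading monomials of `A`, `B` and `L`. As
these relations are syzygies, they form a Gröbner basis, and it is minimal because none of the
listed monomials divides another. Division then gives generation of `𝓝`.

Generation of `℘` is a normal form argument. Every monomial reduces modulo the binomials to a normal
one of the same weight (`exists_normal`). A normal monomial is determined by its weight, by the gcd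
condition (`IsNormal.eq_of_weight_eq`). Hence `η` is injective modulo the binomials.

Finally `℘ = 𝓜 / 𝓝` gives `Sym(℘) = Sym(𝓜) / (𝓝)`, where `Sym(𝓜)` is `R̂` (`ker_symMap`). -/

theorem mcoeff_zero (t : (σ →₀ ℕ) × ι) : mcoeff t (0 : ι →₀ MvPolynomial σ K) = 0 := by
  simp [mcoeff]

theorem mcoeff_add (t : (σ →₀ ℕ) × ι) (H H' : ι →₀ MvPolynomial σ K) :
    mcoeff t (H + H') = mcoeff t H + mcoeff t H' := by
  simp [mcoeff]

theorem mcoeff_sub (t : (σ →₀ ℕ) × ι) (H H' : ι →₀ MvPolynomial σ K) :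
    mcoeff t (H - H') = mcoeff t H - mcoeff t H' := by
  simp [mcoeff]

theorem mcoeff_neg (t : (σ →₀ ℕ) × ι) (H : ι →₀ MvPolynomial σ K) :
    mcoeff t (-H) = -mcoeff t H := by
  simp [mcoeff]

open Classical in
theorem mcoeff_single_monomial (s t : (σ →₀ ℕ) × ι) (c : K) :
    mcoeff s (Finsupp.single t.2 (MvPolynomial.monomial t.1 c)) = if t = s then c else 0 := by
  obtain ⟨α, e⟩ := s
  obtain ⟨β, e'⟩ := t
  by_cases h : e' = e
  · subst h
    simp [mcoeff, MvPolynomial.coeff_monomial]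
  · simp [mcoeff, h]

theorem mcoeff_add_monomial_smul (γ : σ →₀ ℕ) (c : K) (s : (σ →₀ ℕ) × ι)
    (H : ι →₀ MvPolynomial σ K) :
    mcoeff (γ + s.1, s.2) (MvPolynomial.monomial γ c • H) = c * mcoeff s H := by
  simp [mcoeff, MvPolynomial.coeff_monomial_mul]

theorem exists_of_mcoeff_smul_ne_zero {f : MvPolynomial σ K} {s : (σ →₀ ℕ) × ι}
    {H : ι →₀ MvPolynomial σ K} (h : mcoeff s (f • H) ≠ 0) :
    ∃ γ ∈ f.support, ∃ s' : (σ →₀ ℕ) × ι, mcoeff s' H ≠ 0 ∧ s = (γ + s'.1, s'.2) := by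
  classical
  obtain ⟨α, e⟩ := s
  simp only [mcoeff, Finsupp.smul_apply, smul_eq_mul] at h
  have h1 := MvPolynomial.support_mul _ _ (MvPolynomial.mem_support_iff.2 h)
  obtain ⟨γ, hγ, β, hβ, rfl⟩ := Finset.mem_add.1 h1
  exact ⟨γ, hγ, (β, e), MvPolynomial.mem_support_iff.1 hβ, rfl⟩

theorem ext_mcoeff {H H' : ι →₀ MvPolynomial σ K} (h : ∀ t, mcoeff t H = mcoeff t H') :
    H = H' := by
  ext e α
  exact h (α, e)

theorem finite_setOf_mcoeff_ne_zero (H : ι →₀ MvPolynomial σ K) :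
    {s : (σ →₀ ℕ) × ι | mcoeff s H ≠ 0}.Finite := by
  refine ((H.support.finite_toSet).biUnion
    (t := fun e => (fun α => (α, e)) '' ((H e).support : Set (σ →₀ ℕ)))
    fun e _ => ((H e).support.finite_toSet.image _)).subset ?_
  rintro ⟨α, e⟩ h
  simp only [Set.mem_iUnion]
  refine ⟨e, ?_, α, by simpa [mcoeff] using h, rfl⟩
  rw [Finset.mem_coe, Finsupp.mem_support_iff]
  rintro h0
  simp [mcoeff, h0] at h

theorem IsMonomialOrder.exists_leadingMonomial (hgt : IsMonomialOrder gt)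
    {H : ι →₀ MvPolynomial σ K} (hH : H ≠ 0) : ∃ t, IsLeadingMonomial gt H t := by
  have : IsStrictOrder _ gt := { irrefl := hgt.irrefl, trans := hgt.trans }
  have hwf := (finite_setOf_mcoeff_ne_zero H).wellFoundedOn (r := gt)
  have hne : ∃ s, mcoeff s H ≠ 0 := by
    by_contra! h
    exact hH (ext_mcoeff fun t => by rw [h, mcoeff_zero])
  obtain ⟨s, hs⟩ := hne
  obtain ⟨⟨t, ht⟩, -, hmin⟩ := hwf.has_min Set.univ ⟨⟨s, hs⟩, trivial⟩
  refine ⟨t, ht, fun u hu hut => ?_⟩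
  rcases hgt.total u t hut with h | h
  · exact absurd h (hmin ⟨u, hu⟩ trivial)
  · exact h

theorem IsMonomialOrder.leadingMonomial_unique (hgt : IsMonomialOrder gt)
    {H : ι →₀ MvPolynomial σ K} {s t : (σ →₀ ℕ) × ι} (hs : IsLeadingMonomial gt H s)
    (ht : IsLeadingMonomial gt H t) : s = t := by
  by_contra h
  exact hgt.irrefl _ (hgt.trans _ _ _ (hs.2 t ht.1 (Ne.symm h)) (ht.2 s hs.1 h))

theorem mul_left_of_le (hgt : IsMonomialOrder gt) {s t u : (σ →₀ ℕ) × ι} (h : gt u s)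
    (hu : u.1 ≤ t.1) (he : u.2 = t.2) : gt t (t.1 - u.1 + s.1, s.2) := by
  have := hgt.mul_left (t.1 - u.1) _ _ h
  rwa [tsub_add_cancel_of_le hu, he] at this

/-- The division algorithm: if every leading monomial of `N` is divisible by a leading monomial of
an element of `G ⊆ N`, then `G` generates `N`. -/
theorem IsMonomialOrder.span_eq (hgt : IsMonomialOrder gt)
    {N : Submodule (MvPolynomial σ K) (ι →₀ MvPolynomial σ K)} {G : Set (ι →₀ MvPolynomial σ K)}
    (hG : G ⊆ N)
    (hdiv : ∀ H ∈ N, ∀ t, IsLeadingMonomial gt H t →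
      ∃ g ∈ G, ∃ u, IsLeadingMonomial gt g u ∧ u.2 = t.2 ∧ u.1 ≤ t.1) :
    Submodule.span (MvPolynomial σ K) G = N := by
  refine le_antisymm (Submodule.span_le.2 hG) ?_
  have key : ∀ t, ∀ H ∈ N, IsLeadingMonomial gt H t →
      H ∈ Submodule.span (MvPolynomial σ K) G := by
    intro t
    induction t using hgt.wf.induction with
    | _ t ih =>
    intro H hH ht
    obtain ⟨g, hg, u, hu, hut, hle⟩ := hdiv H hH t ht
    set q : ι →₀ MvPolynomial σ K :=
      MvPolynomial.monomial (t.1 - u.1) (mcoeff t H / mcoeff u g) • g with hq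
    have hqG : q ∈ Submodule.span (MvPolynomial σ K) G :=
      Submodule.smul_mem _ _ (Submodule.subset_span hg)
    have hqt : mcoeff t q = mcoeff t H := by
      have := mcoeff_add_monomial_smul (t.1 - u.1) (mcoeff t H / mcoeff u g) u g
      rw [tsub_add_cancel_of_le hle, hut, div_mul_cancel₀ _ hu.1] at this
      exact this
    have hrest : ∀ s, mcoeff s (H - q) ≠ 0 → gt t s := by
      intro s hs
      have hst : s ≠ t := by
        rintro rfl
        rw [mcoeff_sub, hqt, sub_self] at hs
        exact hs rfl
      by_cases h : mcoeff s H = 0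
      · rw [mcoeff_sub, h, zero_sub, neg_ne_zero] at hs
        obtain ⟨γ, hγ, s', hs', rfl⟩ := exists_of_mcoeff_smul_ne_zero hs
        obtain rfl : γ = t.1 - u.1 := by
          simpa using MvPolynomial.support_monomial_subset hγ
        refine mul_left_of_le hgt (hu.2 s' hs' ?_) hle hut
        rintro rfl
        refine hst ?_
        rw [tsub_add_cancel_of_le hle, hut]
      · exact ht.2 s h hst
    have hmem : H - q ∈ Submodule.span (MvPolynomial σ K) G := by
      by_cases h0 : H - q = 0
      · rw [h0]
        exact Submodule.zero_mem _
      · obtain ⟨t', ht'⟩ := hgt.exists_leadingMonomial h0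
        exact ih t' (hrest t' ht'.1) _
          (N.sub_mem hH (Submodule.span_le.2 hG hqG)) ht'
    simpa using Submodule.add_mem _ hmem hqG
  intro H hH
  by_cases h0 : H = 0
  · rw [h0]
    exact Submodule.zero_mem _
  · obtain ⟨t, ht⟩ := hgt.exists_leadingMonomial h0
    exact key t H hH ht

theorem leadingTerms_mono {S T : Set (ι →₀ MvPolynomial σ K)} (h : S ⊆ T) :
    leadingTerms gt S ⊆ leadingTerms gt T := by
  rintro f ⟨H, hH, t, ht⟩
  exact ⟨H, h hH, t, ht⟩

theorem span_leadingTerms_eq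
    {N : Submodule (MvPolynomial σ K) (ι →₀ MvPolynomial σ K)} {G : Set (ι →₀ MvPolynomial σ K)}
    (hG : G ⊆ N)
    (hdiv : ∀ H ∈ N, ∀ t, IsLeadingMonomial gt H t →
      ∃ g ∈ G, ∃ u, IsLeadingMonomial gt g u ∧ u.2 = t.2 ∧ u.1 ≤ t.1) :
    Submodule.span (MvPolynomial σ K) (leadingTerms gt G) =
      Submodule.span (MvPolynomial σ K) (leadingTerms gt (N : Set (ι →₀ MvPolynomial σ K))) := by
  refine le_antisymm (Submodule.span_mono (leadingTerms_mono hG)) (Submodule.span_le.2 ?_)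
  rintro f ⟨H, hH, t, ht, rfl⟩
  obtain ⟨g, hg, u, hu, hut, hle⟩ := hdiv H hH t ht
  have : (Finsupp.single t.2 (MvPolynomial.monomial t.1 (mcoeff t H)) : ι →₀ MvPolynomial σ K) =
      MvPolynomial.monomial (t.1 - u.1) (mcoeff t H / mcoeff u g) •
        Finsupp.single u.2 (MvPolynomial.monomial u.1 (mcoeff u g)) := by
    rw [Finsupp.smul_single, smul_eq_mul, MvPolynomial.monomial_mul, tsub_add_cancel_of_le hle,
      hut, div_mul_cancel₀ _ hu.1]
  rw [this]
  exact Submodule.smul_mem _ _ (Submodule.subset_span ⟨g, hg, u, hu, rfl⟩)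

/-- Every monomial of an element of the span of leading terms is divisible by one of them. -/
theorem exists_dvd_of_mem_span_leadingTerms {S : Set (ι →₀ MvPolynomial σ K)}
    {f : ι →₀ MvPolynomial σ K}
    (hf : f ∈ Submodule.span (MvPolynomial σ K) (leadingTerms gt S)) :
    ∀ t, mcoeff t f ≠ 0 → ∃ g ∈ S, ∃ u, IsLeadingMonomial gt g u ∧ u.2 = t.2 ∧ u.1 ≤ t.1 := by
  classical
  induction hf using Submodule.span_induction with
  | mem f h =>
    obtain ⟨H, hH, u, hu, rfl⟩ := h
    intro t ht
    rw [mcoeff_single_monomial] at ht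
    obtain rfl : u = t := by
      by_contra h
      simp [h] at ht
    exact ⟨H, hH, u, hu, rfl, le_rfl⟩
  | zero => intro t ht; exact absurd (mcoeff_zero t) ht
  | add f g _ _ hf hg =>
    intro t ht
    by_cases h : mcoeff t f = 0
    · rw [mcoeff_add, h, zero_add] at ht
      exact hg t ht
    · exact hf t h
  | smul r f _ hf =>
    intro t ht
    obtain ⟨γ, -, s, hs, rfl⟩ := exists_of_mcoeff_smul_ne_zero ht
    obtain ⟨g, hg, u, hu, hut, hle⟩ := hf s hs
    exact ⟨g, hg, u, hu, hut, hle.trans le_add_self⟩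

/-- Membership of a term in a submodule spanned by terms is divisibility by one of them, so every
condition becomes a statement about exponents. -/
theorem isMinimalGroebnerBasis_of_dvd
    {N : Submodule (MvPolynomial σ K) (ι →₀ MvPolynomial σ K)} {G : Set (ι →₀ MvPolynomial σ K)}
    (hfin : G.Finite) (hG : G ⊆ N)
    (hdiv : ∀ H ∈ N, ∀ t, IsLeadingMonomial gt H t →
      ∃ g ∈ G, ∃ u, IsLeadingMonomial gt g u ∧ u.2 = t.2 ∧ u.1 ≤ t.1)
    (hone : ∀ g ∈ G, ∃ t, IsLeadingMonomial gt g t ∧ mcoeff t g = 1)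
    (hmin : ∀ g ∈ G, ∀ g' ∈ G, ∀ t t', IsLeadingMonomial gt g t → IsLeadingMonomial gt g' t' →
      t'.2 = t.2 → t'.1 ≤ t.1 → g' = g) :
    IsMinimalGroebnerBasis gt N G := by
  classical
  refine ⟨⟨hfin, hG, fun h0 => ?_, span_leadingTerms_eq hG hdiv⟩, fun g hg => ?_⟩
  · obtain ⟨t, -, ht⟩ := hone 0 h0
    rw [mcoeff_zero] at ht
    exact zero_ne_one ht
  · obtain ⟨t, ht, ht1⟩ := hone g hg
    refine ⟨t, ht, ht1, fun hmem => ?_⟩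
    obtain ⟨g', ⟨hg', hne⟩, u, hu, hut, hle⟩ :=
      exists_dvd_of_mem_span_leadingTerms hmem t (by simp [mcoeff_single_monomial, ht1])
    exact hne (hmin g hg g' hg' t u ht hu hut hle)

/-! ### Certifying leading monomials -/

/-- The elements all of whose monomials are less than `t`. -/
def below (K : Type*) [Field K] (gt : (σ →₀ ℕ) × ι → (σ →₀ ℕ) × ι → Prop) (t : (σ →₀ ℕ) × ι) :
    AddSubgroup (ι →₀ MvPolynomial σ K) where
  carrier := {H | ∀ s, mcoeff s H ≠ 0 → gt t s}
  zero_mem' s hs := absurd (mcoeff_zero s) hs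
  add_mem' := by
    intro f g hf hg s hs
    by_cases h : mcoeff s f = 0
    · rw [mcoeff_add, h, zero_add] at hs
      exact hg s hs
    · exact hf s h
  neg_mem' := by
    intro f hf s hs
    rw [mcoeff_neg, neg_ne_zero] at hs
    exact hf s hs

theorem single_monomial_mem_below {s t : (σ →₀ ℕ) × ι} (h : gt t s) (c : K) :
    Finsupp.single s.2 (MvPolynomial.monomial s.1 c) ∈ below K gt t := by
  classical
  intro u hu
  rw [mcoeff_single_monomial] at hu
  obtain rfl : s = u := by
    by_contra h
    simp [h] at hu
  exact h

/-- Since `below` is an additive subgroup, the remaining terms of a relation can be checked one at a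
time, even if some vanish, coincide or cancel. -/
theorem isLeadingMonomial_add_below (hirr : ∀ s, ¬ gt s s) {t : (σ →₀ ℕ) × ι}
    {H : ι →₀ MvPolynomial σ K} (hH : H ∈ below K gt t) :
    IsLeadingMonomial gt (Finsupp.single t.2 (MvPolynomial.monomial t.1 1) + H) t ∧
      mcoeff t (Finsupp.single t.2 (MvPolynomial.monomial t.1 1) + H) = 1 := by
  classical
  have h1 : mcoeff t (Finsupp.single t.2 (MvPolynomial.monomial t.1 1) + H) = 1 := by
    have : mcoeff t H = 0 := by
      by_contra h
      exact hirr t (hH t h)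
    rw [mcoeff_add, mcoeff_single_monomial, if_pos rfl, this, add_zero]
  refine ⟨⟨by simp [h1], fun s hs hst => hH s ?_⟩, h1⟩
  rwa [mcoeff_add, mcoeff_single_monomial, if_neg (Ne.symm hst), zero_add] at hs

end GroebnerModule

namespace MonomialCurve

open MvPolynomial GroebnerModule

/-! ### The orders -/

section Orders

variable {p a b d : ℕ}

theorem ix_val {n : ℕ} (h : n ≤ p) : ((ix p n : Fin (p + 1)) : ℕ) = n := by
  simp [ix, Fin.ofNat, Nat.mod_eq_of_lt (Nat.lt_succ_of_le h)]

theorem ix_fin (k : Fin (p + 1)) : ix p k = k :=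
  Fin.ext (ix_val (Nat.lt_succ_iff.1 k.2))

theorem ix_inj {m n : ℕ} (hm : m ≤ p) (hn : n ≤ p) : ix p m = ix p n ↔ m = n := by
  rw [Fin.ext_iff, ix_val hm, ix_val hn]

theorem single_ix_apply {m n c : ℕ} (hm : m ≤ p) (hn : n ≤ p) :
    (Finsupp.single (ix p m) c : Fin (p + 1) →₀ ℕ) (ix p n) = if m = n then c else 0 := by
  rw [Finsupp.single_apply]
  simp only [ix_inj hm hn]

theorem weight_add (α β : Fin (p + 1) →₀ ℕ) :
    weight p a b d (α + β) = weight p a b d α + weight p a b d β := by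
  simp [weight, add_mul, Finset.sum_add_distrib]

theorem weight_single {n : ℕ} (c : ℕ) (h : n ≤ p) :
    weight p a b d (Finsupp.single (ix p n) c) = c * mseq p a b d n := by
  unfold weight
  rw [Finset.sum_eq_single (ix p n)]
  · simp [ix_val h]
  · intro i _ hi
    rw [Finsupp.single_apply, if_neg (Ne.symm hi), zero_mul]
  · simp

theorem pos_injective : Function.Injective (pos p) := by
  intro i j h
  unfold pos at h
  have := i.2
  have := j.2
  apply Fin.ext
  split_ifs at h <;> omega

theorem gtR_irrefl (α : Fin (p + 1) →₀ ℕ) : ¬ gtR p a b d α α := by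
  rintro (h | ⟨-, k, hk, -⟩) <;> omega

theorem gtR_trans {α β γ : Fin (p + 1) →₀ ℕ} (h1 : gtR p a b d α β) (h2 : gtR p a b d β γ) :
    gtR p a b d α γ := by
  rcases h1 with h1 | ⟨h1, k, hk, hk'⟩ <;> rcases h2 with h2 | ⟨h2, l, hl, hl'⟩
  · exact Or.inl (by omega)
  · exact Or.inl (by omega)
  · exact Or.inl (by omega)
  · refine Or.inr ⟨by omega, ?_⟩
    rcases lt_trichotomy (pos p k) (pos p l) with h | h | h
    · exact ⟨l, by rw [hk' l h]; exact hl, fun i hi => (hk' i (h.trans hi)).trans (hl' i hi)⟩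
    · obtain rfl := pos_injective h
      exact ⟨k, hk.trans hl, fun i hi => (hk' i hi).trans (hl' i hi)⟩
    · exact ⟨k, by rw [← hl' k h]; exact hk, fun i hi => (hk' i hi).trans (hl' i (h.trans hi))⟩

theorem gtR_total {α β : Fin (p + 1) →₀ ℕ} (h : α ≠ β) :
    gtR p a b d α β ∨ gtR p a b d β α := by
  rcases lt_trichotomy (weight p a b d α) (weight p a b d β) with hw | hw | hw
  · exact Or.inr (Or.inl hw)
  · obtain ⟨k₀, hk₀⟩ := Finsupp.ne_iff.1 h
    obtain ⟨k, hk, hmax⟩ := Finset.exists_max_image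
      (Finset.univ.filter fun i => α i ≠ β i) (pos p) ⟨k₀, by simpa using hk₀⟩
    have hk1 : α k ≠ β k := by simpa using hk
    have hl : ∀ l, pos p k < pos p l → α l = β l := by
      intro l hl
      by_contra hne
      exact absurd (hmax l (by simpa using hne)) (not_le.2 hl)
    rcases lt_or_gt_of_ne hk1 with hlt | hlt
    · exact Or.inl (Or.inr ⟨hw, k, hlt, hl⟩)
    · exact Or.inr (Or.inr ⟨hw.symm, k, hlt, fun l h => (hl l h).symm⟩)
  · exact Or.inl (Or.inl hw)

theorem gtR_add {α β : Fin (p + 1) →₀ ℕ} (γ : Fin (p + 1) →₀ ℕ) (h : gtR p a b d α β) :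
    gtR p a b d (γ + α) (γ + β) := by
  rcases h with h | ⟨h, k, hk, hl⟩
  · exact Or.inl (by simp only [weight_add]; omega)
  · exact Or.inr ⟨by simp only [weight_add]; omega, k, by simpa using hk,
      fun l h => by simp [hl l h]⟩

/-- All `m_i` are positive because `b ≥ 1`, so the weight bounds every exponent. This makes the
order well founded although its tie-break is reverse lexicographic. -/
theorem finite_setOf_weight_le (hb : 1 ≤ b) (W : ℕ) :
    {α : Fin (p + 1) →₀ ℕ | weight p a b d α ≤ W}.Finite := by
  refine (Set.finite_Iic (Finsupp.equivFunOnFinite.symm fun _ : Fin (p + 1) => W)).subset ?_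
  intro α hα i
  refine le_trans ?_ hα
  have h1 : α i * mseq p a b d i ≤ weight p a b d α :=
    Finset.single_le_sum (f := fun i : Fin (p + 1) => α i * mseq p a b d i)
      (fun _ _ => Nat.zero_le _) (Finset.mem_univ i)
  have h2 : 1 ≤ mseq p a b d i := by unfold mseq; omega
  exact (Nat.le_mul_of_pos_right _ h2).trans h1

/-- A transitive irreflexive relation is well founded if its lower sets are finite. -/
theorem wellFounded_of_finite {X : Type*} {r : X → X → Prop} (hirr : ∀ x, ¬ r x x)
    (htrans : ∀ x y z, r x y → r y z → r x z) (hfin : ∀ x, {y | r y x}.Finite) :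
    WellFounded r := by
  have : IsStrictOrder X r := { irrefl := hirr, trans := htrans }
  refine WellFounded.wellFounded_iff_has_min.2 fun S ⟨x, hx⟩ => ?_
  by_cases hne : (S ∩ {y | r y x}).Nonempty
  · have hwf := ((hfin x).inter_of_right S).wellFoundedOn (r := r)
    obtain ⟨y, hy⟩ := hne
    obtain ⟨⟨m, hm⟩, -, hmin⟩ := hwf.has_min Set.univ ⟨⟨y, hy⟩, trivial⟩
    exact ⟨m, hm.1, fun z hz hzm => hmin ⟨z, hz, htrans _ _ _ hzm hm.2⟩ trivial hzm⟩
  · exact ⟨x, hx, fun y hy hyx => hne ⟨y, hy, hyx⟩⟩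

theorem weight_le_of_gtR {α β : Fin (p + 1) →₀ ℕ} (h : gtR p a b d α β) :
    weight p a b d β ≤ weight p a b d α := by
  rcases h with h | h
  · exact h.le
  · exact h.1.ge

theorem gtR_wf (hb : 1 ≤ b) : WellFounded fun α β => gtR p a b d β α :=
  wellFounded_of_finite gtR_irrefl (fun _ _ _ h1 h2 => gtR_trans h2 h1)
    fun _ => (finite_setOf_weight_le hb _).subset fun _ h => weight_le_of_gtR h

/-! ### Leading and trailing monomials of the binomials -/

/-- The leading exponent of the binomial of `e`. -/
noncomputable def leadExp (p a b : ℕ) : Gen p b → (Fin (p + 1) →₀ ℕ)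
  | .psi i _ => Finsupp.single (ix p p) a + Finsupp.single (ix p (b + i)) 1
  | .phi i j _ _ _ => Finsupp.single (ix p i) 1 + Finsupp.single (ix p j) 1

/-- The trailing exponent of the binomial of `e`. -/
noncomputable def tailExp (p a b d : ℕ) : Gen p b → (Fin (p + 1) →₀ ℕ)
  | .psi i _ => Finsupp.single (ix p i) 1 + Finsupp.single (ix p 0) (a + d)
  | .phi i j _ _ _ =>
      Finsupp.single (ix p (eps p i j)) 1 + Finsupp.single (ix p (i + j - eps p i j)) 1

theorem varpi_eq (α : Fin (p + 1) →₀ ℕ) (e : Gen p b) :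
    varpi p a b (α, e) = α + leadExp p a b e := by
  cases e <;> simp [varpi, leadExp, add_assoc]

theorem binom_eq (K : Type*) [Field K] (e : Gen p b) :
    binom K p a b d e = monomial (leadExp p a b e) 1 - monomial (tailExp p a b d e) 1 := by
  cases e with
  | psi i hi =>
    simp only [binom, psiPoly, x, leadExp, tailExp, X_pow_eq_monomial]
    simp only [X, monomial_mul, mul_one]
    rw [add_comm (Finsupp.single (ix p (b + i)) 1)]
  | phi i j =>
    simp only [binom, phiPoly, x, leadExp, tailExp, X, monomial_mul, mul_one]

/-- `X_0` stands last in the exponent tuple, so among monomials of equal weight its exponent decides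
first, and the smaller exponent wins. -/
theorem gtR_of_zero_lt {α β : Fin (p + 1) →₀ ℕ} (hw : weight p a b d α = weight p a b d β)
    (h : α (ix p 0) < β (ix p 0)) : gtR p a b d α β := by
  refine Or.inr ⟨hw, ix p 0, h, fun l hl => ?_⟩
  have := l.2
  have h0 : ((ix p 0 : Fin (p + 1)) : ℕ) = 0 := ix_val (Nat.zero_le p)
  unfold pos at hl
  split_ifs at hl <;> omega

theorem gtR_of_last_lt (hp : 1 ≤ p) {α β : Fin (p + 1) →₀ ℕ}
    (hw : weight p a b d α = weight p a b d β)
    (h0 : α (ix p 0) = β (ix p 0)) (h : α (ix p p) < β (ix p p)) : gtR p a b d α β := by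
  refine Or.inr ⟨hw, ix p p, h, fun l hl => ?_⟩
  have := l.2
  have hpp : ((ix p p : Fin (p + 1)) : ℕ) = p := ix_val le_rfl
  have hl0 : l = ix p 0 := by
    apply Fin.ext
    rw [ix_val (Nat.zero_le p)]
    unfold pos at hl
    split_ifs at hl <;> omega
  rw [hl0, h0]

theorem weight_pair {i j k l : ℕ} (hi : i ≤ p) (hj : j ≤ p) (hk : k ≤ p) (hl : l ≤ p)
    (h : i + j = k + l) :
    weight p a b d (Finsupp.single (ix p i) 1 + Finsupp.single (ix p j) 1) =
      weight p a b d (Finsupp.single (ix p k) 1 + Finsupp.single (ix p l) 1) := by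
  simp only [weight_add, weight_single, hi, hj, hk, hl, mseq]
  have : (i + j) * d = (k + l) * d := by rw [h]
  linarith

theorem weight_leadExp (e : Gen p b) :
    weight p a b d (leadExp p a b e) = weight p a b d (tailExp p a b d e) := by
  cases e with
  | psi i hi =>
    simp only [leadExp, tailExp, weight_add]
    rw [weight_single _ le_rfl, weight_single _ hi, weight_single _ (by omega),
      weight_single _ (Nat.zero_le p)]
    simp only [mseq]
    ring
  | phi i j hi hij hj =>
    refine weight_pair (by omega) (by omega) ?_ ?_ ?_ <;> unfold eps <;> split_ifs <;> omega

/-- Both monomials have the same weight. The tail has the larger power of `X_0`, except for `Φ(i,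
j)` with `i + j > p`, where `X_0` is absent from both and the tail contains `X_p`. For `i + j = p`
the tail is `X_p X_0`, which falls under the first case. -/
theorem gtR_leadExp_tailExp (ha : 1 ≤ a) (hb : 1 ≤ b) (e : Gen p b) :
    gtR p a b d (leadExp p a b e) (tailExp p a b d e) := by
  cases e with
  | psi i hi =>
    refine gtR_of_zero_lt (weight_leadExp _) ?_
    simp only [leadExp, tailExp, Finsupp.add_apply]
    rw [single_ix_apply le_rfl (Nat.zero_le p), single_ix_apply hi (Nat.zero_le p),
      single_ix_apply (by omega) (Nat.zero_le p), single_ix_apply (Nat.zero_le p) (Nat.zero_le p)]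
    split_ifs <;> omega
  | phi i j hi hij hj =>
    by_cases h : i + j ≤ p
    · refine gtR_of_zero_lt (weight_leadExp _) ?_
      have h1 : eps p i j = i + j := by unfold eps; split_ifs <;> omega
      simp only [leadExp, tailExp, Finsupp.add_apply, h1, Nat.sub_self]
      rw [single_ix_apply (by omega) (by omega), single_ix_apply (by omega) (by omega),
        single_ix_apply (by omega) (by omega), single_ix_apply (by omega) (by omega)]
      split_ifs <;> omega
    · have h1 : eps p i j = p := by unfold eps; split_ifs <;> omega
      refine gtR_of_last_lt (by omega) (weight_leadExp _) ?_ ?_ <;>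
      · simp only [leadExp, tailExp, Finsupp.add_apply, h1]
        rw [single_ix_apply (by omega) (by omega), single_ix_apply (by omega) (by omega),
          single_ix_apply (by omega) (by omega), single_ix_apply (by omega) (by omega)]
        split_ifs <;> omega

theorem gtGen_irrefl (e : Gen p b) : ¬ gtGen p b e e := by
  cases e <;> simp [gtGen]

theorem gtGen_trans {e f g : Gen p b} (h1 : gtGen p b e f) (h2 : gtGen p b f g) :
    gtGen p b e g := by
  cases e <;> cases f <;> cases g <;> simp only [gtGen] at * <;> omega

theorem gtGen_total {e f : Gen p b} (h : e ≠ f) : gtGen p b e f ∨ gtGen p b f e := by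
  cases e <;> cases f <;> simp [gtGen] at * <;> omega

instance : Finite (Gen p b) := by
  refine Finite.of_injective (β := Option (Fin (p + 1)) × Fin (p + 1))
    (fun e => match e with
      | .psi i h => (none, ⟨i, by omega⟩)
      | .phi i j _ _ _ => (some ⟨i, by omega⟩, ⟨j, by omega⟩)) ?_
  intro e f h
  cases e <;> cases f <;> simp_all

theorem gtM_trans {s t u : (Fin (p + 1) →₀ ℕ) × Gen p b} (h1 : gtM p a b d s t)
    (h2 : gtM p a b d t u) : gtM p a b d s u := by
  rcases h1 with h1 | ⟨h1, h1'⟩ <;> rcases h2 with h2 | ⟨h2, h2'⟩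
  · exact Or.inl (gtR_trans h1 h2)
  · exact Or.inl (h2 ▸ h1)
  · exact Or.inl (h1 ▸ h2)
  · exact Or.inr ⟨h1.trans h2, gtGen_trans h1' h2'⟩

theorem gtM_irrefl (s : (Fin (p + 1) →₀ ℕ) × Gen p b) : ¬ gtM p a b d s s := by
  rintro (h | ⟨-, h⟩)
  · exact gtR_irrefl _ h
  · exact gtGen_irrefl _ h

theorem weight_le_varpi (s : (Fin (p + 1) →₀ ℕ) × Gen p b) :
    weight p a b d s.1 ≤ weight p a b d (varpi p a b s) := by
  obtain ⟨α, e⟩ := s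
  rw [varpi_eq, weight_add]
  exact Nat.le_add_right _ _

theorem isMonomialOrder_gtM (hb : 1 ≤ b) : IsMonomialOrder (gtM p a b d) where
  irrefl := gtM_irrefl
  trans _ _ _ := gtM_trans
  total := by
    rintro ⟨α, e⟩ ⟨β, f⟩ h
    by_cases hv : varpi p a b (α, e) = varpi p a b (β, f)
    · have hef : e ≠ f := by
        rintro rfl
        rw [varpi_eq, varpi_eq] at hv
        exact h (by rw [add_right_cancel hv])
      rcases gtGen_total hef with h | h
      · exact Or.inl (Or.inr ⟨hv, h⟩)
      · exact Or.inr (Or.inr ⟨hv.symm, h⟩)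
    · rcases gtR_total hv with h | h
      · exact Or.inl (Or.inl h)
      · exact Or.inr (Or.inl h)
  mul_left := by
    rintro γ ⟨α, e⟩ ⟨β, f⟩ h
    simp only [gtM, varpi_eq, add_assoc] at h ⊢
    rcases h with h | ⟨h, h'⟩
    · exact Or.inl (gtR_add γ h)
    · exact Or.inr ⟨by rw [h], h'⟩
  wf := by
    refine wellFounded_of_finite gtM_irrefl (fun _ _ _ h1 h2 => gtM_trans h2 h1) fun s => ?_
    refine ((finite_setOf_weight_le (a := a) (d := d) hb (weight p a b d (varpi p a b s))).prod
      (Set.finite_univ (α := Gen p b))).subset ?_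
    intro t ht
    refine ⟨(weight_le_varpi t).trans ?_, trivial⟩
    rcases ht with h | ⟨h, -⟩
    · exact weight_le_of_gtR h
    · rw [h]

end Orders

/-! ### Leading monomials of syzygies -/

section Leading

variable {K : Type*} [Field K] {p a b d : ℕ}

/-- The coefficient of `ϖ(t)` in `∑ H_e g_e = 0` must vanish, so the contribution of `t` has to be
cancelled by another leading product. This is the only place where the syzygy condition constrains
leading monomials. -/
theorem exists_varpi_eq_of_mem_syzygies (ha : 1 ≤ a) (hb : 1 ≤ b) {H : M K p b}
    (hH : H ∈ syzygies K p a b d) {t : (Fin (p + 1) →₀ ℕ) × Gen p b}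
    (ht : IsLeadingMonomial (gtM p a b d) H t) :
    ∃ s, varpi p a b t = varpi p a b s ∧ gtGen p b t.2 s.2 := by
  classical
  by_contra! hno
  have hzero : ∀ s, s ≠ t → varpi p a b s = varpi p a b t → mcoeff s H = 0 := by
    intro s hst hv
    by_contra hs
    rcases ht.2 s hs hst with h | ⟨-, h⟩
    · rw [hv] at h
      exact gtR_irrefl _ h
    · exact hno s hv.symm h
  -- A monomial of `H` whose tail product is `ϖ(t)` has a strictly greater `ϖ`, so it would exceed
  -- `t`.
  have htail : ∀ e, (H e * monomial (tailExp p a b d e) (1 : K)).coeff (varpi p a b t) = 0 := by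
    intro e
    rw [coeff_mul_monomial', mul_one]
    split_ifs with hle
    · by_contra hc
      set s : (Fin (p + 1) →₀ ℕ) × Gen p b := (varpi p a b t - tailExp p a b d e, e) with hs
      have hgt : gtR p a b d (varpi p a b s) (varpi p a b t) := by
        have := gtR_add (varpi p a b t - tailExp p a b d e)
          (gtR_leadExp_tailExp (d := d) ha hb e)
        rwa [tsub_add_cancel_of_le hle, ← varpi_eq] at this
      have hst : s ≠ t := by
        intro h
        rw [h] at hgt
        exact gtR_irrefl _ hgt
      exact gtM_irrefl t (gtM_trans (ht.2 s hc hst) (Or.inl hgt))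
    · rfl
  -- A leading product equal to `ϖ(t)` comes from a monomial with the same `ϖ`, and `hzero` leaves
  -- only `t` itself.
  have hlead : ∀ e, (H e * monomial (leadExp p a b e) (1 : K)).coeff (varpi p a b t) =
      if e = t.2 then mcoeff t H else 0 := by
    intro e
    rw [coeff_mul_monomial', mul_one]
    split_ifs with hle he he
    · subst he
      have : varpi p a b t - leadExp p a b t.2 = t.1 := by
        rw [← Prod.mk.eta (p := t), varpi_eq, add_tsub_cancel_right]
      rw [this]
      rfl
    · refine hzero (varpi p a b t - leadExp p a b e, e) ?_ ?_
      · exact fun h => he (congrArg Prod.snd h)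
      · rw [varpi_eq, tsub_add_cancel_of_le hle]
    · refine absurd ?_ hle
      rw [← Prod.mk.eta (p := t), varpi_eq, he]
      exact le_add_self
    · rfl
  have hsum : (Finsupp.linearCombination (R K p) (binom K p a b d) H).coeff (varpi p a b t) =
      mcoeff t H := by
    rw [Finsupp.linearCombination_apply, Finsupp.sum, coeff_sum, Finset.sum_eq_single t.2]
    · rw [smul_eq_mul, binom_eq, mul_sub, coeff_sub, hlead, htail, if_pos rfl, sub_zero]
    · intro e _ he
      rw [smul_eq_mul, binom_eq, mul_sub, coeff_sub, hlead, htail, if_neg he, sub_zero]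
    · intro h
      rw [Finsupp.notMem_support_iff.1 h]
      simp
  rw [LinearMap.mem_ker.1 hH, coeff_zero] at hsum
  exact ht.1 hsum.symm

end Leading

end MonomialCurve

namespace MonomialCurve

open MvPolynomial GroebnerModule

/-! ### The relations are syzygies -/

section Relations

variable {K : Type*} [Field K] {p a b d : ℕ}

theorem Psi_eq {i : ℕ} (h : b + i ≤ p) : Psi K p b i = Finsupp.single (Gen.psi i h) 1 :=
  dif_pos h

theorem Phi_comm (i j : ℕ) : Phi K p b i j = Phi K p b j i := by
  simp only [Phi, min_comm i j, max_comm i j]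

theorem Phi_eq {i j : ℕ} (hi : 1 ≤ i) (hij : i ≤ j) (hj : j < p) :
    Phi K p b i j = Finsupp.single (Gen.phi i j hi hij hj) 1 := by
  have h : 1 ≤ min i j ∧ max i j < p := by
    rw [min_eq_left hij, max_eq_right hij]
    exact ⟨hi, hj⟩
  rw [Phi, dif_pos h]
  congr 2
  · exact min_eq_left hij
  · exact max_eq_right hij

/-- The normal form of `X_i X_j` for `i + j = s`. -/
noncomputable def normalQuadratic (K : Type*) [Field K] (p s : ℕ) : R K p :=
  if s < p then x K p 0 * x K p s else x K p p * x K p (s - p)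

theorem tau_mul_eq (i j : ℕ) :
    x K p (tau p i j) * x K p (i + j - tau p i j) = normalQuadratic K p (i + j) := by
  unfold normalQuadratic tau
  split_ifs <;> simp

theorem eps_mul_eq (i j : ℕ) :
    x K p (eps p i j) * x K p (i + j - eps p i j) = normalQuadratic K p (i + j) := by
  unfold normalQuadratic eps
  split_ifs
  · simp [mul_comm]
  · rfl

theorem phiPoly_eq (i j : ℕ) :
    phiPoly K p i j = x K p i * x K p j - normalQuadratic K p (i + j) := by
  rw [phiPoly, eps_mul_eq]

theorem phiPoly_comm (i j : ℕ) : phiPoly K p i j = phiPoly K p j i := by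
  rw [phiPoly_eq, phiPoly_eq, mul_comm, add_comm i]

/-- With `phiPoly_last_left`, this makes the convention `Φ(i, j) = 0` at the boundary indices `0`
and `p` compatible with the binomials. -/
theorem phiPoly_zero_left {j : ℕ} (hj : j ≤ p) : phiPoly K p 0 j = 0 := by
  rw [phiPoly_eq, zero_add, normalQuadratic]
  split_ifs with h
  · ring
  · obtain rfl : j = p := by omega
    rw [Nat.sub_self]
    ring

theorem phiPoly_last_left (j : ℕ) : phiPoly K p p j = 0 := by
  rw [phiPoly_eq, normalQuadratic, if_neg (by omega), Nat.add_sub_cancel_left, sub_self]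

theorem linearCombination_Psi {i : ℕ} (h : b + i ≤ p) :
    Finsupp.linearCombination (R K p) (binom K p a b d) (Psi K p b i) = psiPoly K p a b d i := by
  rw [Psi_eq h, Finsupp.linearCombination_single, one_smul]
  rfl

theorem linearCombination_Phi {i j : ℕ} (hi : i ≤ p) (hj : j ≤ p) :
    Finsupp.linearCombination (R K p) (binom K p a b d) (Phi K p b i j) = phiPoly K p i j := by
  wlog hij : i ≤ j generalizing i j
  · rw [Phi_comm, phiPoly_comm]
    exact this hj hi (by omega)
  by_cases h0 : i = 0
  · subst h0
    rw [phiPoly_zero_left hj, Phi, dif_neg (by simp), map_zero]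
  · by_cases h1 : j = p
    · subst h1
      rw [phiPoly_comm, phiPoly_last_left, Phi, dif_neg (by simp), map_zero]
    · rw [Phi_eq (by omega) hij (by omega), Finsupp.linearCombination_single, one_smul]
      rfl

/-- Rewrite `X_i X_{b+j}` in `X_i ψ(b, j)` by `φ(i, b + j)`, obtaining `X_u X_v` with `u = ε(i, b +
j) ≥ b`; then `X_v ψ(b, u - b)` takes over. What remains is `X_0^{a+d}` times a difference of two
quadratic monomials with index sum `i + j`, which is a difference of two `φ`'s. -/
theorem relA_mem {i j : ℕ} (hi : i ≤ p) (hb : 1 ≤ b) (hj : b + j < p) :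
    relA K p a b d i j ∈ syzygies K p a b d := by
  have h1 : eps p i (b + j) ≤ p := by unfold eps; split_ifs <;> omega
  have h2 : b ≤ eps p i (b + j) := by unfold eps; split_ifs <;> omega
  rw [syzygies, LinearMap.mem_ker, relA]
  simp only [map_add, map_sub, map_smul, smul_eq_mul]
  rw [linearCombination_Psi hj.le, linearCombination_Psi (by omega),
    linearCombination_Phi hi hj.le, linearCombination_Phi hi (by omega),
    linearCombination_Phi (by omega) (by omega)]
  have h3 : b + (eps p i (b + j) - b) = eps p i (b + j) := by omega
  have h4 := eps_mul_eq (K := K) (p := p) i (b + j)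
  have h5 : i + (b + j) = b + i + j := by omega
  -- If `b + i + j < p`, then the left side is already normal, and the truncated index `0` makes the
  -- `φ` term vanish.
  have h6 : x K p (b + i + j - eps p i (b + j)) * x K p (eps p i (b + j) - b) =
      normalQuadratic K p (i + j) + phiPoly K p (b + i + j - p) (p - b) := by
    by_cases h : b + i + j < p
    · have : b + i + j - p = 0 := by omega
      rw [this, phiPoly_zero_left (by omega), normalQuadratic, if_pos (by omega), add_zero, eps,
        if_pos (by omega)]
      congr 2 <;> omega
    · rw [phiPoly_eq, eps, if_neg (by omega)]
      have : b + i + j - p + (p - b) = i + j := by omega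
      rw [this]
      ring
  rw [h5] at h4
  simp only [psiPoly, phiPoly_eq i, h3, h5]
  linear_combination (x K p p ^ a) * (-h4) + (x K p 0 ^ (a + d)) * h6

/-- This is the Koszul relation between `ψ(b, p - b)` and `φ(i, j)`. -/
theorem relB_mem (hbp : b ≤ p) {i j : ℕ} (hi : i ≤ p) (hj : j ≤ p) :
    relB K p a b d i j ∈ syzygies K p a b d := by
  rw [syzygies, LinearMap.mem_ker, relB]
  simp only [map_sub, map_smul, smul_eq_mul]
  rw [linearCombination_Psi (by omega), linearCombination_Phi hi hj]
  simp only [phiPoly]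
  ring

/-- The normal form of `X_i X_j X_l` for `i + j + l = s`. -/
noncomputable def normalCubic (K : Type*) [Field K] (p s : ℕ) : R K p :=
  if s < p then x K p 0 * (x K p 0 * x K p s)
  else if s < 2 * p then x K p 0 * (x K p p * x K p (s - p))
  else x K p p * (x K p p * x K p (s - 2 * p))

/-- Reducing two factors first and then the third gives a result that depends only on the index sum;
this associativity makes the `L` relations work. -/
theorem tau_mul_normalQuadratic {i j l : ℕ} (hl : l < p) :
    x K p (tau p i j) * normalQuadratic K p (i + j - tau p i j + l) =
      normalCubic K p (i + j + l) := by
  unfold normalQuadratic normalCubic tau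
  by_cases h1 : i + j < p
  · simp only [h1, if_true, Nat.sub_zero]
    rw [if_pos (by omega : i + j + l < 2 * p)]
    split_ifs <;> rfl
  · simp only [h1, if_false]
    rw [if_neg (by omega : ¬ i + j + l < p)]
    by_cases h2 : i + j + l < 2 * p
    · rw [if_pos (by omega), if_pos h2, show i + j - p + l = i + j + l - p by omega]
      ring
    · rw [if_neg (by omega), if_neg h2, show i + j - p + l - p = i + j + l - 2 * p by omega]

/-- Both `X_l φ(i, j)` and `X_j φ(i, l)` start with `X_i X_j X_l`. Completing the reduction on
either side ends in the same normal cubic, so the difference is zero. -/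
theorem relL_mem {l i j : ℕ} (hl : l < p) (hi : i < p) (hj : j < p) :
    relL K p b l i j ∈ syzygies K p a b d := by
  rw [syzygies, LinearMap.mem_ker, relL]
  have h1 : i + j - tau p i j ≤ p := by unfold tau; split_ifs <;> omega
  have h2 : i + l - tau p i l ≤ p := by unfold tau; split_ifs <;> omega
  simp only [map_sub, map_add, map_smul, smul_eq_mul]
  rw [linearCombination_Phi hi.le hj.le, linearCombination_Phi hi.le hl.le,
    linearCombination_Phi h1 hl.le, linearCombination_Phi h2 hj.le]
  simp only [phiPoly_eq]
  have e1 := tau_mul_eq (K := K) (p := p) i j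
  have e2 := tau_mul_eq (K := K) (p := p) i l
  have e3 := tau_mul_normalQuadratic (K := K) (p := p) (i := i) (j := j) hl
  have e4 := tau_mul_normalQuadratic (K := K) (p := p) (i := i) (j := l) hj
  rw [show i + l + j = i + j + l by omega] at e4
  linear_combination x K p l * e1 - x K p j * e2 - e3 + e4

/-! ### The leading monomials of the relations -/

theorem monomial_smul_Psi_mem_below {t : (Fin (p + 1) →₀ ℕ) × Gen p b} {γ : Fin (p + 1) →₀ ℕ}
    {i : ℕ} (h : ∀ hi : b + i ≤ p, gtM p a b d t (γ, .psi i hi)) :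
    (monomial γ 1 : R K p) • Psi K p b i ∈ below K (gtM p a b d) t := by
  by_cases hi : b + i ≤ p
  · rw [Psi_eq hi, Finsupp.smul_single, smul_eq_mul, mul_one]
    exact single_monomial_mem_below (h hi) 1
  · rw [Psi, dif_neg hi, smul_zero]
    exact zero_mem _

/-- The comparison is required only for indices in range, since otherwise the term is zero. It uses
the unsorted pair `i, j`, because `ϖ` does not depend on their order. -/
theorem monomial_smul_Phi_mem_below {t : (Fin (p + 1) →₀ ℕ) × Gen p b} {γ : Fin (p + 1) →₀ ℕ}
    {i j : ℕ} (h : 1 ≤ min i j → max i j < p →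
      gtR p a b d (varpi p a b t)
        (γ + (Finsupp.single (ix p i) 1 + Finsupp.single (ix p j) 1)) ∨
      varpi p a b t = γ + (Finsupp.single (ix p i) 1 + Finsupp.single (ix p j) 1) ∧
        ∀ h1 h2 h3, gtGen p b t.2 (.phi (min i j) (max i j) h1 h2 h3)) :
    (monomial γ 1 : R K p) • Phi K p b i j ∈ below K (gtM p a b d) t := by
  by_cases hi : 1 ≤ min i j ∧ max i j < p
  · rw [Phi, dif_pos hi, Finsupp.smul_single, smul_eq_mul, mul_one]
    have hv : varpi p a b (γ, Gen.phi (min i j) (max i j) hi.1 min_le_max hi.2) =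
        γ + (Finsupp.single (ix p i) 1 + Finsupp.single (ix p j) 1) := by
      rw [varpi_eq, leadExp]
      rcases le_total i j with h | h
      · rw [min_eq_left h, max_eq_right h]
      · rw [min_eq_right h, max_eq_left h, add_comm (Finsupp.single (ix p i) 1)]
    refine single_monomial_mem_below (K := K)
      (s := (γ, Gen.phi (min i j) (max i j) hi.1 min_le_max hi.2)) ?_ 1
    unfold gtM
    rw [hv]
    exact (h hi.1 hi.2).imp_right fun h => ⟨h.1, h.2 _ _ _⟩
  · rw [Phi, dif_neg hi, smul_zero]
    exact zero_mem _

theorem gtR_pair {i j : ℕ} (ha : 1 ≤ a) (hb : 1 ≤ b) (hi : 1 ≤ i) (hip : i < p) (hj : 1 ≤ j)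
    (hjp : j < p) :
    gtR p a b d (Finsupp.single (ix p i) 1 + Finsupp.single (ix p j) 1)
      (Finsupp.single (ix p (eps p i j)) 1 + Finsupp.single (ix p (i + j - eps p i j)) 1) := by
  wlog hij : i ≤ j generalizing i j
  · have := this hj hjp hi hip (by omega)
    have he : eps p j i = eps p i j := by simp only [eps, add_comm]
    rwa [he, add_comm j, add_comm (Finsupp.single (ix p j) 1)] at this
  exact gtR_leadExp_tailExp ha hb (Gen.phi (p := p) (b := b) i j hi hij hjp)

theorem gtR_pair_tau {i j : ℕ} (ha : 1 ≤ a) (hb : 1 ≤ b) (hi : 1 ≤ i) (hip : i < p) (hj : 1 ≤ j)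
    (hjp : j < p) :
    gtR p a b d (Finsupp.single (ix p i) 1 + Finsupp.single (ix p j) 1)
      (Finsupp.single (ix p (tau p i j)) 1 + Finsupp.single (ix p (i + j - tau p i j)) 1) := by
  have h := gtR_pair (d := d) ha hb hi hip hj hjp
  unfold tau
  unfold eps at h
  split_ifs at h ⊢
  · rw [Nat.sub_self, add_comm (Finsupp.single (ix p (i + j)) 1)] at h
    rwa [Nat.sub_zero]
  · exact h

theorem x_eq_monomial (n : ℕ) : x K p n = monomial (Finsupp.single (ix p n) 1) 1 := rfl

theorem x_pow_eq_monomial (n c : ℕ) : x K p n ^ c = monomial (Finsupp.single (ix p n) c) 1 := by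
  rw [x, X_pow_eq_monomial]

theorem x_mul_x_eq_monomial (m n : ℕ) : x K p m * x K p n =
    monomial (Finsupp.single (ix p m) 1 + Finsupp.single (ix p n) 1) 1 := by
  rw [x_eq_monomial, x_eq_monomial, monomial_mul, mul_one]

/-- The terms with `X_0^{a+d}` are smaller because `ϖ(t)` is free of `X_0`. The term `X_p^a Φ(i, b +
j)` ties in `ϖ` and loses because every `Ψ` precedes every `Φ`. -/
theorem isLeadingMonomial_relA (ha : 1 ≤ a) (hb : 1 ≤ b) {i j : ℕ} (hi : 1 ≤ i) (hip : i ≤ p)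
    (hj : b + j < p) :
    IsLeadingMonomial (gtM p a b d) (relA K p a b d i j)
        (Finsupp.single (ix p i) 1, .psi j hj.le) ∧
      mcoeff (Finsupp.single (ix p i) 1, .psi j hj.le) (relA K p a b d i j) = 1 := by
  set t : (Fin (p + 1) →₀ ℕ) × Gen p b := (Finsupp.single (ix p i) 1, .psi j hj.le) with ht
  have hvt : varpi p a b t = Finsupp.single (ix p i) 1 +
      (Finsupp.single (ix p p) a + Finsupp.single (ix p (b + j)) 1) := varpi_eq _ _
  have hvt0 : varpi p a b t (ix p 0) = 0 := by
    simp only [hvt, Finsupp.add_apply]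
    rw [single_ix_apply hip (Nat.zero_le p), single_ix_apply le_rfl (Nat.zero_le p),
      single_ix_apply hj.le (Nat.zero_le p), if_neg (by omega), if_neg (by omega),
      if_neg (by omega), add_zero, add_zero]
  have hvtw : weight p a b d (varpi p a b t) =
      mseq p a b d i + (a * mseq p a b d p + mseq p a b d (b + j)) := by
    rw [hvt]
    simp only [weight_add]
    rw [weight_single _ hip, weight_single _ le_rfl, weight_single _ hj.le, one_mul, one_mul]
  have hzero : ∀ k l, k ≤ p → l ≤ p → k + l = i + j →
      gtR p a b d (varpi p a b t) (Finsupp.single (ix p 0) (a + d) +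
        (Finsupp.single (ix p k) 1 + Finsupp.single (ix p l) 1)) := by
    intro k l hk hl hkl
    refine gtR_of_zero_lt ?_ ?_
    · rw [hvtw]
      simp only [weight_add]
      rw [weight_single _ (Nat.zero_le p), weight_single _ hk, weight_single _ hl]
      simp only [mseq]
      have : (k + l) * d = (i + j) * d := by rw [hkl]
      linarith
    · rw [hvt0]
      simp only [Finsupp.add_apply]
      rw [single_ix_apply (Nat.zero_le p) (Nat.zero_le p), if_pos rfl]
      omega
  have hrel : relA K p a b d i j = Finsupp.single t.2 (monomial t.1 1) +
      (-(x K p (b + i + j - eps p i (b + j)) • Psi K p b (eps p i (b + j) - b))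
        - x K p p ^ a • Phi K p b i (b + j)
        + (x K p 0 ^ (a + d) • Phi K p b i j
          - x K p 0 ^ (a + d) • Phi K p b (b + i + j - p) (p - b))) := by
    rw [relA, Psi_eq hj.le, Finsupp.smul_single, smul_eq_mul, mul_one, ← smul_sub, x_eq_monomial i]
    abel
  rw [hrel]
  refine isLeadingMonomial_add_below gtM_irrefl
    (add_mem (sub_mem (neg_mem ?_) ?_) (sub_mem ?_ ?_))
  · refine monomial_smul_Psi_mem_below fun h => ?_
    rcases hip.lt_or_eq with hlt | rfl
    · refine Or.inl ?_
      have h3 : b + (eps p i (b + j) - b) = eps p i (b + j) := by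
        unfold eps; split_ifs <;> omega
      have := gtR_add (Finsupp.single (ix p p) a)
        (gtR_pair (d := d) ha hb hi hlt (by omega) hj)
      rw [hvt, varpi_eq, leadExp, h3]
      convert this using 1
      · abel
      · rw [show i + (b + j) = b + i + j by omega]
        abel
    -- For `i = p` the second term is `X_{b+j} Ψ(b, p - b)`, with the same `ϖ`; it loses the tie
    -- because `j < p - b`.
    · refine Or.inr ⟨?_, ?_⟩
      · have h3 : eps i i (b + j) = i := by unfold eps; split_ifs <;> omega
        rw [hvt, varpi_eq, leadExp, h3, show b + i + j - i = b + j by omega,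
          show b + (i - b) = i by omega]
        abel
      · simp only [ht, gtGen]
        unfold eps
        split_ifs <;> omega
  · rw [x_pow_eq_monomial]
    refine monomial_smul_Phi_mem_below fun _ _ => Or.inr ⟨?_, fun _ _ _ => trivial⟩
    rw [hvt]
    abel
  · rw [x_pow_eq_monomial]
    exact monomial_smul_Phi_mem_below fun _ _ => Or.inl (hzero _ _ hip (by omega) rfl)
  · rw [x_pow_eq_monomial]
    exact monomial_smul_Phi_mem_below fun h1 _ =>
      Or.inl (hzero _ _ (by omega) (by omega) (by omega))

theorem psiPoly_eq_monomial {i : ℕ} (hi : b + i ≤ p) :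
    psiPoly K p a b d i =
      monomial (leadExp p a b (.psi i hi)) 1 - monomial (tailExp p a b d (.psi i hi)) 1 :=
  binom_eq K (Gen.psi i hi)

theorem isLeadingMonomial_relB (ha : 1 ≤ a) (hb : 1 ≤ b) {i j : ℕ} (hi : 1 ≤ i)
    (hip : i < p) (hj : 1 ≤ j) (hjp : j < p) (hbp : b + (p - b) ≤ p) :
    IsLeadingMonomial (gtM p a b d) (relB K p a b d i j)
        (Finsupp.single (ix p i) 1 + Finsupp.single (ix p j) 1, .psi (p - b) hbp) ∧
      mcoeff (Finsupp.single (ix p i) 1 + Finsupp.single (ix p j) 1, .psi (p - b) hbp)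
        (relB K p a b d i j) = 1 := by
  set t : (Fin (p + 1) →₀ ℕ) × Gen p b :=
    (Finsupp.single (ix p i) 1 + Finsupp.single (ix p j) 1, .psi (p - b) hbp) with ht
  have hvt : varpi p a b t = Finsupp.single (ix p i) 1 + Finsupp.single (ix p j) 1 +
      leadExp p a b (.psi (p - b) hbp) := varpi_eq _ _
  have hrel : relB K p a b d i j = Finsupp.single t.2 (monomial t.1 1) +
      (-((monomial (Finsupp.single (ix p (eps p i j)) 1 +
            Finsupp.single (ix p (i + j - eps p i j)) 1) 1 : R K p) • Psi K p b (p - b))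
        - ((monomial (leadExp p a b (.psi (p - b) hbp)) 1 : R K p) • Phi K p b i j
        - (monomial (tailExp p a b d (.psi (p - b) hbp)) 1 : R K p) • Phi K p b i j)) := by
    rw [relB, Psi_eq hbp, Finsupp.smul_single, smul_eq_mul, mul_one, ← sub_smul,
      x_mul_x_eq_monomial, x_mul_x_eq_monomial, psiPoly_eq_monomial hbp]
    abel
  rw [hrel]
  refine isLeadingMonomial_add_below gtM_irrefl (sub_mem (neg_mem ?_) (sub_mem ?_ ?_))
  · refine monomial_smul_Psi_mem_below fun h => Or.inl ?_
    rw [hvt, varpi_eq, add_comm, add_comm _ (leadExp p a b _)]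
    exact gtR_add _ (gtR_pair ha hb hi hip hj hjp)
  · refine monomial_smul_Phi_mem_below fun _ _ => Or.inr ⟨?_, fun _ _ _ => trivial⟩
    rw [hvt]
    abel
  · refine monomial_smul_Phi_mem_below fun _ _ => Or.inl ?_
    rw [hvt, add_comm (tailExp _ _ _ _ _)]
    exact gtR_add _ (gtR_leadExp_tailExp ha hb _)

/-- Only `X_j Φ(i, l)` ties with the leading monomial. Because `l < j`, its sorted pair has a
smaller maximum, or, when `i = j`, the same maximum and a smaller minimum. -/
theorem isLeadingMonomial_relL (ha : 1 ≤ a) (hb : 1 ≤ b) {l i j : ℕ} (hl : 1 ≤ l) (hi : 1 ≤ i)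
    (hij : i ≤ j) (hlj : l < j) (hj : j < p) :
    IsLeadingMonomial (gtM p a b d) (relL K p b l i j)
        (Finsupp.single (ix p l) 1, .phi i j hi hij hj) ∧
      mcoeff (Finsupp.single (ix p l) 1, .phi i j hi hij hj) (relL K p b l i j) = 1 := by
  set t : (Fin (p + 1) →₀ ℕ) × Gen p b :=
    (Finsupp.single (ix p l) 1, .phi i j hi hij hj) with ht
  have hvt : varpi p a b t = Finsupp.single (ix p l) 1 +
      (Finsupp.single (ix p i) 1 + Finsupp.single (ix p j) 1) := varpi_eq _ _
  have hrel : relL K p b l i j = Finsupp.single t.2 (monomial t.1 1) +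
      (-(x K p j • Phi K p b i l)
        + x K p (tau p i j) • Phi K p b (i + j - tau p i j) l
        - x K p (tau p i l) • Phi K p b (i + l - tau p i l) j) := by
    rw [relL, Phi_eq hi hij hj, Finsupp.smul_single, smul_eq_mul, mul_one, x_eq_monomial l]
    abel
  rw [hrel]
  refine isLeadingMonomial_add_below gtM_irrefl (sub_mem (add_mem (neg_mem ?_) ?_) ?_)
  · refine monomial_smul_Phi_mem_below fun _ _ => Or.inr ⟨?_, fun _ _ _ => ?_⟩
    · rw [hvt]
      abel
    · simp only [ht, gtGen]
      omega
  · refine monomial_smul_Phi_mem_below fun _ _ => Or.inl ?_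
    have := gtR_add (Finsupp.single (ix p l) 1)
      (gtR_pair_tau (d := d) ha hb hi (by omega) (by omega) hj)
    rw [hvt]
    convert this using 1
    abel
  · refine monomial_smul_Phi_mem_below fun _ _ => Or.inl ?_
    have := gtR_add (Finsupp.single (ix p j) 1)
      (gtR_pair_tau (d := d) ha hb hi (by omega : i < p) hl (by omega))
    rw [hvt]
    convert this using 1 <;> abel

/-! ### The minimal Gröbner basis -/

theorem Ghat_finite : (Ghat K p a b d).Finite := by
  have h2 : ((Set.Iic p ×ˢ Set.Iic p : Set (ℕ × ℕ))).Finite :=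
    (Set.finite_Iic p).prod (Set.finite_Iic p)
  have h3 : ((Set.Iic p ×ˢ (Set.Iic p ×ˢ Set.Iic p) : Set (ℕ × ℕ × ℕ))).Finite :=
    (Set.finite_Iic p).prod h2
  refine ((Set.Finite.subset (h2.image fun q => relA K p a b d q.1 q.2) ?_).union
    (Set.Finite.subset (h2.image fun q => relB K p a b d q.1 q.2) ?_)).union
    (Set.Finite.subset (h3.image fun q => relL K p b q.1 q.2.1 q.2.2) ?_)
  · rintro H ⟨i, j, h1, h2, h3, rfl⟩
    exact ⟨(i, j), ⟨h2, show j ≤ p by omega⟩, rfl⟩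
  · rintro H ⟨i, j, h1, h2, h3, h4, rfl⟩
    exact ⟨(i, j), ⟨h2.le, h4.le⟩, rfl⟩
  · rintro H ⟨l, i, j, h1, h2, h3, h4, h5, rfl⟩
    exact ⟨(l, i, j), ⟨show l ≤ p by omega, show i ≤ p by omega, h5.le⟩, rfl⟩

theorem Ghat_subset_syzygies (hb : 1 ≤ b) (hbp : b ≤ p) :
    Ghat K p a b d ⊆ syzygies K p a b d := by
  rintro H ((⟨i, j, h1, h2, h3, rfl⟩ | ⟨i, j, h1, h2, h3, h4, rfl⟩) |
    ⟨l, i, j, h1, h2, h3, h4, h5, rfl⟩)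
  · exact relA_mem h2 hb h3
  · exact relB_mem hbp h2.le h4.le
  · exact relL_mem (by omega) (by omega) h5

/-- Comparing the exponents in `X^α in(g_e) = X^β in(g_f)`, where `e` precedes `f`, forces a
variable, or a product of two, into `X^α`; that factor selects the relation. -/
theorem exists_leadingMonomial_dvd (ha : 1 ≤ a) (hb : 1 ≤ b)
    {H : M K p b} (hH : H ∈ syzygies K p a b d) (t : (Fin (p + 1) →₀ ℕ) × Gen p b)
    (ht : IsLeadingMonomial (gtM p a b d) H t) :
    ∃ g ∈ Ghat K p a b d, ∃ u, IsLeadingMonomial (gtM p a b d) g u ∧ u.2 = t.2 ∧ u.1 ≤ t.1 := by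
  have hle1 : ∀ {n : ℕ} {α : Fin (p + 1) →₀ ℕ}, 1 ≤ α (ix p n) →
      Finsupp.single (ix p n) 1 ≤ α := by
    intro n α h
    rwa [Finsupp.single_le_iff]
  obtain ⟨⟨β, f⟩, hv, hgen⟩ := exists_varpi_eq_of_mem_syzygies ha hb hH ht
  obtain ⟨α, e⟩ := t
  rw [varpi_eq, varpi_eq] at hv
  have hv' : ∀ n, α (ix p n) + leadExp p a b e (ix p n) =
      β (ix p n) + leadExp p a b f (ix p n) := fun n => DFunLike.congr_fun hv (ix p n)
  have memA : ∀ i j (hj : b + j < p), 1 ≤ i → i ≤ p → e = .psi j hj.le → 1 ≤ α (ix p i) →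
      ∃ g ∈ Ghat K p a b d, ∃ u, IsLeadingMonomial (gtM p a b d) g u ∧ u.2 = e ∧ u.1 ≤ α := by
    rintro i j hj hi hip rfl hα
    exact ⟨_, Or.inl (Or.inl ⟨i, j, hi, hip, hj, rfl⟩), _,
      (isLeadingMonomial_relA ha hb hi hip hj).1, rfl, hle1 hα⟩
  cases e with
  | psi j hj =>
    cases f with
    | psi k hk =>
      have hjk : j < k := hgen
      have h := hv' (b + k)
      simp only [leadExp, Finsupp.add_apply] at h
      rw [single_ix_apply hj hk, single_ix_apply hk hk, if_neg (by omega), if_pos rfl] at h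
      exact memA (b + k) j (by omega) (by omega) hk rfl (by omega)
    | phi i k hi hik hk =>
      have h1 := hv' i
      have h2 := hv' k
      simp only [leadExp, Finsupp.add_apply] at h1 h2
      have hip : i ≤ p := by omega
      have hkp : k ≤ p := by omega
      rw [single_ix_apply hj hip, single_ix_apply le_rfl hip, single_ix_apply hip hip,
        single_ix_apply hkp hip] at h1
      rw [single_ix_apply hj hkp, single_ix_apply le_rfl hkp, single_ix_apply hip hkp,
        single_ix_apply hkp hkp] at h2
      -- If `b + j < p`, then `X_{b+j}` may absorb one of `X_i`, `X_k`, but not both, so one of them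
      -- divides `X^α`. If `b + j = p`, the leading monomial is `X_p^{a+1}`, which absorbs neither,
      -- and the whole product divides `X^α`.
      by_cases hjb : b + j < p
      · by_cases hαi : 1 ≤ α (ix p i)
        · exact memA i j hjb hi hip rfl hαi
        · refine memA k j hjb (by omega) hkp rfl ?_
          split_ifs at h1 h2 <;> omega
      · obtain rfl : j = p - b := by omega
        refine ⟨_, Or.inl (Or.inr ⟨i, k, hi, by omega, by omega, hk, rfl⟩), _,
          (isLeadingMonomial_relB ha hb hi (by omega) (by omega) hk hj).1, rfl, ?_⟩
        rw [if_neg (by omega), if_neg (by omega), if_pos rfl] at h1 h2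
        intro m
        change (Finsupp.single (ix p i) 1 + Finsupp.single (ix p k) 1 : Fin (p + 1) →₀ ℕ) m ≤ α m
        rw [Finsupp.add_apply, Finsupp.single_apply, Finsupp.single_apply]
        by_cases hmi : ix p i = m
        · subst hmi
          rw [if_pos rfl]
          simp only [ix_inj hkp hip]
          omega
        · by_cases hmk : ix p k = m
          · subst hmk
            rw [if_neg hmi, if_pos rfl]
            omega
          · rw [if_neg hmi, if_neg hmk]
            exact Nat.zero_le _
  | phi i j hi hij hj =>
    cases f with
    | psi k hk => exact hgen.elim
    | phi i' j' hi' hij' hj' =>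
      have hgen' : j' < j ∨ (j = j' ∧ i' < i) := hgen
      have h1 := hv' i'
      have h2 := hv' j'
      simp only [leadExp, Finsupp.add_apply] at h1 h2
      rw [single_ix_apply (by omega) (by omega), single_ix_apply (by omega) (by omega),
        single_ix_apply (by omega) (by omega), single_ix_apply (by omega) (by omega)] at h1 h2
      have memL : ∀ l, 1 ≤ l → l < j → 1 ≤ α (ix p l) →
          ∃ g ∈ Ghat K p a b d, ∃ u, IsLeadingMonomial (gtM p a b d) g u ∧
            u.2 = .phi i j hi hij hj ∧ u.1 ≤ α := fun l hl hlj hα =>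
        ⟨_, Or.inr ⟨l, i, j, hl, hi, hij, hlj, hj, rfl⟩, _,
          (isLeadingMonomial_relL ha hb hl hi hij hlj hj).1, rfl, hle1 hα⟩
      by_cases hα : 1 ≤ α (ix p i')
      · exact memL i' hi' (by omega) hα
      -- If `X_{i'}` does not divide `X^α`, it must come from `X_i X_j`. For `j' < j` this forces
      -- `i' = i` and `i' ≠ j'`, so `X_{j'}` divides `X^α`. For `j' = j` it is impossible, since `i'
      -- < i ≤ j`.
      · by_cases hjj : j' < j
        · refine memL j' (by omega) hjj ?_
          split_ifs at h1 h2 <;> omega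
        · exfalso
          split_ifs at h1 <;> omega

/-- `B(i, j)` ranges over ordered pairs, so minimality needs the two orders to give the same
element. -/
theorem relB_comm (i j : ℕ) : relB K p a b d i j = relB K p a b d j i := by
  have he : eps p j i = eps p i j := by simp only [eps, add_comm]
  rw [relB, relB, he, add_comm j, mul_comm (x K p j), Phi_comm j]

theorem leadingMonomial_of_mem_Ghat (ha : 1 ≤ a) (hb : 1 ≤ b) (hbp : b ≤ p)
    {g : M K p b} (hg : g ∈ Ghat K p a b d) :
    ∃ t, (IsLeadingMonomial (gtM p a b d) g t ∧ mcoeff t g = 1) ∧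
      ((∃ i j, ∃ hj : b + j < p, i ≤ p ∧ t = (Finsupp.single (ix p i) 1, .psi j hj.le) ∧
          g = relA K p a b d i j) ∨
        (∃ i j, ∃ hbp : b + (p - b) ≤ p, i ≤ p ∧ j ≤ p ∧
          t = (Finsupp.single (ix p i) 1 + Finsupp.single (ix p j) 1, .psi (p - b) hbp) ∧
          g = relB K p a b d i j) ∨
        (∃ l i j hi hij hj, l ≤ p ∧ t = (Finsupp.single (ix p l) 1, .phi i j hi hij hj) ∧
          g = relL K p b l i j)) := by
  obtain ((⟨i, j, h1, h2, h3, rfl⟩ | ⟨i, j, h1, h2, h3, h4, rfl⟩) |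
    ⟨l, i, j, h1, h2, h3, h4, h5, rfl⟩) := hg
  · exact ⟨_, isLeadingMonomial_relA ha hb h1 h2 h3, Or.inl ⟨i, j, h3, h2, rfl, rfl⟩⟩
  · exact ⟨_, isLeadingMonomial_relB ha hb h1 h2 h3 h4 (by omega),
      Or.inr (Or.inl ⟨i, j, _, h2.le, h4.le, rfl, rfl⟩)⟩
  · exact ⟨_, isLeadingMonomial_relL ha hb h1 h2 h3 h4 h5,
      Or.inr (Or.inr ⟨l, i, j, _, _, _, by omega, rfl, rfl⟩)⟩

theorem eq_of_single_le_single {m n : ℕ} (hm : m ≤ p) (hn : n ≤ p)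
    (h : (Finsupp.single (ix p m) 1 : Fin (p + 1) →₀ ℕ) ≤ Finsupp.single (ix p n) 1) : m = n := by
  have := h (ix p m)
  rw [single_ix_apply hm hm, single_ix_apply hn hm, if_pos rfl] at this
  split_ifs at this <;> omega

theorem eq_of_leadingMonomial_dvd (ha : 1 ≤ a) (hb : 1 ≤ b) (hbp : b ≤ p)
    {g g' : M K p b} (hg : g ∈ Ghat K p a b d) (hg' : g' ∈ Ghat K p a b d)
    {t t' : (Fin (p + 1) →₀ ℕ) × Gen p b} (ht : IsLeadingMonomial (gtM p a b d) g t)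
    (ht' : IsLeadingMonomial (gtM p a b d) g' t') (he : t'.2 = t.2) (hle : t'.1 ≤ t.1) :
    g' = g := by
  obtain ⟨s, ⟨hs, -⟩, hc⟩ := leadingMonomial_of_mem_Ghat ha hb hbp hg
  obtain ⟨s', ⟨hs', -⟩, hc'⟩ := leadingMonomial_of_mem_Ghat ha hb hbp hg'
  obtain rfl := (isMonomialOrder_gtM hb).leadingMonomial_unique ht hs
  obtain rfl := (isMonomialOrder_gtM hb).leadingMonomial_unique ht' hs'
  clear ht ht' hs hs'
  rcases hc with ⟨i, j, hj, hi, rfl, rfl⟩ | ⟨i, j, hbp', hi, hj, rfl, rfl⟩ |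
      ⟨l, i, j, hi, hij, hj, hl, rfl, rfl⟩ <;>
    rcases hc' with ⟨i', j', hj', hi', rfl, rfl⟩ | ⟨i', j', hbp'', hi', hj', rfl, rfl⟩ |
      ⟨l', i', j', hi', hij', hj', hl', rfl, rfl⟩ <;>
    simp only [Gen.psi.injEq, Gen.phi.injEq, reduceCtorEq] at he
  · rw [he, eq_of_single_le_single hi' hi hle]
  -- An `A` and a `B` never share a basis element: `A` has `Ψ(b, j)` with `b + j < p`, while `B` has
  -- `Ψ(b, p - b)`.
  · omega
  · omega
  · have h1 := hle (ix p i')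
    have h2 := hle (ix p j')
    simp only [Finsupp.add_apply] at h1 h2
    rw [single_ix_apply (by omega) (by omega), single_ix_apply (by omega) (by omega),
      single_ix_apply (by omega) (by omega), single_ix_apply (by omega) (by omega)] at h1 h2
    have : (i' = i ∧ j' = j) ∨ (i' = j ∧ j' = i) := by
      split_ifs at h1 h2 <;> omega
    rcases this with ⟨rfl, rfl⟩ | ⟨rfl, rfl⟩
    · rfl
    · exact relB_comm _ _
  · rw [he.1, he.2, eq_of_single_le_single hl' hl hle]

theorem isMinimalGroebnerBasis_Ghat (ha : 1 ≤ a) (hb : 1 ≤ b) (hbp : b ≤ p) :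
    IsMinimalGroebnerBasis (gtM p a b d) (syzygies K p a b d) (Ghat K p a b d) := by
  refine isMinimalGroebnerBasis_of_dvd Ghat_finite (Ghat_subset_syzygies hb hbp)
    (fun _ hH t ht => exists_leadingMonomial_dvd ha hb hH t ht) (fun g hg => ?_)
    fun g hg g' hg' t t' ht ht' => eq_of_leadingMonomial_dvd ha hb hbp hg hg' ht ht'
  obtain ⟨t, ht, -⟩ := leadingMonomial_of_mem_Ghat ha hb hbp hg
  exact ⟨t, ht⟩

theorem span_Ghat (ha : 1 ≤ a) (hb : 1 ≤ b) (hbp : b ≤ p) :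
    Submodule.span (R K p) (Ghat K p a b d) = syzygies K p a b d :=
  (isMonomialOrder_gtM hb).span_eq (Ghat_subset_syzygies hb hbp)
    fun _ hH t ht => exists_leadingMonomial_dvd ha hb hH t ht

end Relations

end MonomialCurve

namespace MonomialCurve

open MvPolynomial GroebnerModule

/-! ### Generators of the ideal of the curve -/

section CurveIdeal

variable {K : Type*} [Field K] {p a b d : ℕ}

/-- A monomial is normal if no leading monomial of a binomial divides it. -/
def IsNormal (p a b : ℕ) (α : Fin (p + 1) →₀ ℕ) : Prop := ∀ e : Gen p b, ¬ leadExp p a b e ≤ α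

/-- Well-founded rewriting: replacing a leading monomial by its tail lowers the monomial and keeps
the weight. -/
theorem exists_normal (ha : 1 ≤ a) (hb : 1 ≤ b) (α : Fin (p + 1) →₀ ℕ) :
    ∃ β, IsNormal p a b β ∧ weight p a b d β = weight p a b d α ∧
      (monomial α 1 - monomial β 1 : R K p) ∈ Ideal.span (Set.range (binom K p a b d)) := by
  induction α using (gtR_wf (a := a) (d := d) hb).induction with
  | _ α ih =>
  by_cases h : IsNormal p a b α
  · exact ⟨α, h, rfl, by rw [sub_self]; exact zero_mem _⟩
  · simp only [IsNormal, not_forall, not_not] at h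
    obtain ⟨e, he⟩ := h
    have hadd : α - leadExp p a b e + leadExp p a b e = α := tsub_add_cancel_of_le he
    have hgt := gtR_add (α - leadExp p a b e) (gtR_leadExp_tailExp (d := d) ha hb e)
    rw [hadd] at hgt
    obtain ⟨β, hβ, hw, hmem⟩ := ih _ hgt
    refine ⟨β, hβ, ?_, ?_⟩
    · rw [hw, weight_add, ← weight_leadExp, ← weight_add, hadd]
    · have h1 : (monomial (α - leadExp p a b e) 1 : R K p) * binom K p a b d e =
          monomial α 1 - monomial (α - leadExp p a b e + tailExp p a b d e) 1 := by
        rw [binom_eq, mul_sub, monomial_mul, monomial_mul, mul_one, hadd]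
      have h2 : (monomial (α - leadExp p a b e) 1 : R K p) * binom K p a b d e ∈
          Ideal.span (Set.range (binom K p a b d)) :=
        Ideal.mul_mem_left _ _ (Ideal.subset_span ⟨e, rfl⟩)
      rw [h1] at h2
      have := add_mem h2 hmem
      rwa [sub_add_sub_cancel] at this

theorem finsupp_ext_ix {α β : Fin (p + 1) →₀ ℕ} (h : ∀ n ≤ p, α (ix p n) = β (ix p n)) :
    α = β := by
  ext k
  rw [← ix_fin k]
  exact h _ (Nat.lt_succ_iff.1 k.2)

theorem leadExp_le_iff {α : Fin (p + 1) →₀ ℕ} {e : Gen p b} :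
    leadExp p a b e ≤ α ↔ ∀ n ≤ p, leadExp p a b e (ix p n) ≤ α (ix p n) := by
  refine ⟨fun h n _ => h _, fun h k => ?_⟩
  rw [← ix_fin k]
  exact h _ (Nat.lt_succ_iff.1 k.2)

/-- The normal monomials are `X_0^c X_p^n` and `X_0^c X_p^n X_i`, with `n p + i < a p + b`. -/
theorem IsNormal.exists_eq (hp : 1 ≤ p) (hb : 1 ≤ b) (hbp : b ≤ p) {α : Fin (p + 1) →₀ ℕ}
    (h : IsNormal p a b α) :
    ∃ c n i, i < p ∧ n * p + i < a * p + b ∧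
      α = Finsupp.single (ix p 0) c + Finsupp.single (ix p p) n +
        if i = 0 then 0 else Finsupp.single (ix p i) 1 := by
  have hpsi : ∀ i, b + i ≤ p → a ≤ α (ix p p) → b + i < p → α (ix p (b + i)) = 0 := by
    intro i hi hap hlt
    by_contra h0
    refine h (.psi i hi) (leadExp_le_iff.2 fun n hn => ?_)
    simp only [leadExp, Finsupp.add_apply]
    rw [single_ix_apply le_rfl hn, single_ix_apply hi hn]
    by_cases h1 : p = n
    · subst h1
      rw [if_pos rfl, if_neg (by omega)]
      exact hap
    · rw [if_neg h1]
      by_cases h2 : b + i = n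
      · subst h2
        rw [if_pos rfl]
        omega
      · rw [if_neg h2]
        exact Nat.zero_le _
  -- The binomial `ψ(b, p - b)` has leading monomial `X_p^{a+1}`.
  have hlast : α (ix p p) ≤ a := by
    by_contra h0
    refine h (.psi (p - b) (by omega)) (leadExp_le_iff.2 fun n hn => ?_)
    simp only [leadExp, Finsupp.add_apply]
    rw [single_ix_apply le_rfl hn, single_ix_apply (by omega) hn]
    by_cases h1 : p = n
    · subst h1
      rw [if_pos rfl, if_pos (by omega)]
      omega
    · rw [if_neg h1, if_neg (by omega)]
      exact Nat.zero_le _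
  have hphi : ∀ i j, 1 ≤ i → i < j → j < p → 1 ≤ α (ix p i) → α (ix p j) = 0 := by
    intro i j hi hij hj hαi
    by_contra h0
    refine h (.phi i j hi hij.le hj) (leadExp_le_iff.2 fun n hn => ?_)
    simp only [leadExp, Finsupp.add_apply]
    rw [single_ix_apply (by omega) hn, single_ix_apply (by omega) hn]
    by_cases h1 : i = n
    · subst h1
      rw [if_pos rfl, if_neg (by omega)]
      omega
    · rw [if_neg h1]
      by_cases h2 : j = n
      · subst h2
        rw [if_pos rfl]
        omega
      · rw [if_neg h2]
        exact Nat.zero_le _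
  have hphi' : ∀ i, 1 ≤ i → i < p → α (ix p i) ≤ 1 := by
    intro i hi hip
    by_contra h0
    refine h (.phi i i hi le_rfl hip) (leadExp_le_iff.2 fun n hn => ?_)
    simp only [leadExp, Finsupp.add_apply]
    rw [single_ix_apply (by omega) hn]
    by_cases h1 : i = n
    · subst h1
      rw [if_pos rfl]
      omega
    · rw [if_neg h1]
      exact Nat.zero_le _
  by_cases hmid : ∃ i, 1 ≤ i ∧ i < p ∧ 1 ≤ α (ix p i)
  · obtain ⟨i, hi, hip, hαi⟩ := hmid
    refine ⟨α (ix p 0), α (ix p p), i, hip, ?_, finsupp_ext_ix fun n hn => ?_⟩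
    -- With exactly `a` factors `X_p`, the `ψ`'s exclude every `X_i` with `b ≤ i < p`; this gives
    -- the strict bound by `a p + b`.
    · rcases hlast.lt_or_eq with hlt | heq
      · have : (α (ix p p) + 1) * p ≤ a * p := Nat.mul_le_mul_right p hlt
        linarith
      · rw [heq]
        have : i < b := by
          by_contra hib
          have := hpsi (i - b) (by omega) heq.ge (by omega)
          rw [show b + (i - b) = i by omega] at this
          omega
        omega
    · rw [if_neg (by omega)]
      simp only [Finsupp.add_apply]
      rw [single_ix_apply (by omega) hn, single_ix_apply (by omega) hn,
        single_ix_apply (by omega) hn]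
      by_cases h1 : n = i
      · subst h1
        have := hphi' n hi hip
        rw [if_neg (by omega), if_neg (by omega), if_pos rfl]
        omega
      · by_cases h2 : 0 = n
        · subst h2
          rw [if_pos rfl, if_neg (by omega), if_neg (by omega)]
          rfl
        · by_cases h3 : p = n
          · subst h3
            rw [if_neg (by omega), if_pos rfl, if_neg (by omega), zero_add, add_zero]
          · rw [if_neg h2, if_neg h3, if_neg (by omega)]
            rcases Nat.lt_or_gt_of_ne h1 with h4 | h4
            · by_contra h5
              have := hphi n i (by omega) h4 hip (by omega)
              omega
            · exact hphi i n hi h4 (by omega) hαi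
  · push Not at hmid
    refine ⟨α (ix p 0), α (ix p p), 0, by omega, ?_, finsupp_ext_ix fun n hn => ?_⟩
    · have := Nat.mul_le_mul_right p hlast
      omega
    · rw [if_pos rfl, add_zero]
      simp only [Finsupp.add_apply]
      rw [single_ix_apply (by omega) hn, single_ix_apply (by omega) hn]
      by_cases h2 : 0 = n
      · subst h2
        rw [if_pos rfl, if_neg (by omega), add_zero]
      · by_cases h3 : p = n
        · subst h3
          rw [if_neg (by omega), if_pos rfl, zero_add]
        · have := hmid n (by omega) (by omega)
          rw [if_neg h2, if_neg h3]
          omega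

theorem weight_normal {c n i : ℕ} (hi : i < p) :
    weight p a b d (Finsupp.single (ix p 0) c + Finsupp.single (ix p p) n +
        if i = 0 then 0 else Finsupp.single (ix p i) 1) =
      (c + n + if i = 0 then 0 else 1) * (a * p + b) + (n * p + i) * d := by
  have h0 : weight p a b d 0 = 0 := by simp [weight]
  rw [weight_add, weight_add, weight_single _ (Nat.zero_le p), weight_single _ le_rfl]
  split_ifs with h
  · subst h
    rw [h0]
    simp only [mseq]
    ring
  · rw [weight_single _ hi.le]
    simp only [mseq]
    ring

/-- Modulo `m_0` the weight is `(n p + i) d`. As `d` is invertible modulo `m_0` and `n p + i < m_0`,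
the weight determines `n p + i`. Division by `p` then gives `n` and `i`, and the weight itself gives
`c`. -/
theorem IsNormal.eq_of_weight_eq (hp : 1 ≤ p) (hb : 1 ≤ b) (hbp : b ≤ p)
    (hgcd : Nat.gcd (a * p + b) d = 1) {α β : Fin (p + 1) →₀ ℕ} (hα : IsNormal p a b α)
    (hβ : IsNormal p a b β) (hw : weight p a b d α = weight p a b d β) : α = β := by
  obtain ⟨c, n, i, hi, hlt, rfl⟩ := hα.exists_eq hp hb hbp
  obtain ⟨c', n', i', hi', hlt', rfl⟩ := hβ.exists_eq hp hb hbp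
  rw [weight_normal hi, weight_normal hi'] at hw
  have hmod : (n * p + i) * d ≡ (n' * p + i') * d [MOD a * p + b] := by
    have := congrArg (· % (a * p + b)) hw
    simpa only [Nat.ModEq, Nat.mul_add_mod_self_right] using this
  have hq : n * p + i = n' * p + i' :=
    Nat.ModEq.eq_of_lt_of_lt (hmod.cancel_right_of_coprime hgcd) hlt hlt'
  have hii : i = i' := by
    have := congrArg (· % p) hq
    simpa only [Nat.mul_add_mod_self_right, Nat.mod_eq_of_lt hi, Nat.mod_eq_of_lt hi'] using this
  subst hii
  have hnn : n = n' := Nat.eq_of_mul_eq_mul_right hp (Nat.add_right_cancel hq)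
  subst hnn
  have hcc := Nat.eq_of_mul_eq_mul_right (by omega) (Nat.add_right_cancel hw)
  have : c = c' := by omega
  rw [this]

theorem eta_monomial (α : Fin (p + 1) →₀ ℕ) (k : K) :
    eta K p a b d (monomial α k) = Polynomial.monomial (weight p a b d α) k := by
  rw [eta, aeval_monomial, Finsupp.prod_fintype _ _ (by simp), ← Polynomial.C_mul_X_pow_eq_monomial]
  congr 1
  simp_rw [← pow_mul]
  rw [Finset.prod_pow_eq_pow_sum]
  congr 1
  exact Finset.sum_congr rfl fun i _ => mul_comm _ _

theorem span_binom_eq_curveIdeal (hp : 1 ≤ p) (ha : 1 ≤ a) (hb : 1 ≤ b) (hbp : b ≤ p)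
    (hgcd : Nat.gcd (a * p + b) d = 1) :
    Ideal.span (Set.range (binom K p a b d)) = curveIdeal K p a b d := by
  classical
  refine le_antisymm (Ideal.span_le.2 ?_) fun f hf => ?_
  · rintro _ ⟨e, rfl⟩
    exact binom_mem K p a b d e
  · set I := Ideal.span (Set.range (binom K p a b d)) with hI
    -- Send `T^w` to the class of the unique normal monomial of weight `w`, and to `0` if there is
    -- none. Then `s ∘ η` is the quotient map, so `η f = 0` puts `f` in the ideal.
    have hsec : ∃ s : Polynomial K →ₗ[K] R K p ⧸ I, ∀ α : Fin (p + 1) →₀ ℕ,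
        s (Polynomial.monomial (weight p a b d α) 1) = Ideal.Quotient.mk I (monomial α 1) := by
      refine ⟨(Polynomial.basisMonomials K).constr K fun w =>
        if h : ∃ α, IsNormal p a b α ∧ weight p a b d α = w then
          Ideal.Quotient.mk I (monomial h.choose 1) else 0, fun α => ?_⟩
      obtain ⟨β, hβ, hw, hmem⟩ := exists_normal (K := K) (d := d) ha hb α
      have h : ∃ γ, IsNormal p a b γ ∧ weight p a b d γ = weight p a b d α := ⟨β, hβ, hw⟩
      rw [← congrFun (Polynomial.coe_basisMonomials K), Module.Basis.constr_basis, dif_pos h,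
        h.choose_spec.1.eq_of_weight_eq hp hb hbp hgcd hβ (h.choose_spec.2.trans hw.symm)]
      exact (Ideal.Quotient.eq.2 hmem).symm
    obtain ⟨s, hs⟩ := hsec
    have hcomp : s ∘ₗ (eta K p a b d).toLinearMap = (Ideal.Quotient.mkₐ K I).toLinearMap := by
      refine MvPolynomial.linearMap_ext fun α => LinearMap.ext_ring ?_
      change s (eta K p a b d (monomial α 1)) = Ideal.Quotient.mk I (monomial α 1)
      rw [eta_monomial, hs]
    have h := LinearMap.congr_fun hcomp f
    have hf0 : eta K p a b d f = 0 := hf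
    change s (eta K p a b d f) = Ideal.Quotient.mk I f at h
    rw [hf0, map_zero] at h
    exact Ideal.Quotient.eq_zero_iff_mem.1 h.symm

end CurveIdeal

/-! ### The symmetric algebra -/

section Symmetric

variable {K : Type*} [Field K] {p a b d : ℕ}

theorem linForm_single (e : Gen p b) (f : R K p) :
    linForm K p b (Finsupp.single e f) = f • (X e : Rhat K p b) := by
  rw [linForm, Finsupp.linearCombination_single]

theorem range_linForm : LinearMap.range (linForm K p b) =
    homogeneousSubmodule (Gen p b) (R K p) 1 := by
  rw [linForm, Finsupp.range_linearCombination, homogeneousSubmodule_one_eq_span_X]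

theorem reesMap_linForm (H : M K p b) : reesMap K p a b d (linForm K p b H) =
    Polynomial.C (Finsupp.linearCombination (R K p) (binom K p a b d) H) * Polynomial.X := by
  induction H using Finsupp.induction_linear with
  | zero => simp
  | add f g hf hg => rw [map_add, map_add, hf, hg, map_add, Polynomial.C_add, add_mul]
  | single e f =>
    rw [linForm_single, map_smul, reesMap, aeval_X, Finsupp.linearCombination_single, smul_eq_mul,
      Polynomial.C_mul, Polynomial.smul_eq_C_mul, mul_assoc]

/-- On a linear form the map to `R[t]` is `(∑ f_e g_e) t`, which vanishes exactly for syzygies. -/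
theorem map_linForm_syzygies : Submodule.map (linForm K p b) (syzygies K p a b d) =
    linearRelations K p a b d := by
  have hiff : ∀ H : M K p b,
      H ∈ syzygies K p a b d ↔ reesMap K p a b d (linForm K p b H) = 0 := by
    intro H
    rw [reesMap_linForm, syzygies, LinearMap.mem_ker]
    simp
  ext F
  rw [linearRelations, Submodule.mem_inf, ← range_linForm]
  constructor
  · rintro ⟨H, hH, rfl⟩
    exact ⟨⟨H, rfl⟩, (hiff H).1 hH⟩
  · rintro ⟨⟨H, rfl⟩, hF⟩
    exact ⟨H, (hiff H).2 hF, rfl⟩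

theorem idealL_eq_span {G : Set (M K p b)}
    (hG : Submodule.span (R K p) G = syzygies K p a b d) :
    idealL K p a b d = Ideal.span (linForm K p b '' G) := by
  rw [idealL, ← map_linForm_syzygies, ← hG, Submodule.map_span]
  exact Submodule.span_span_of_tower (R K p) (Rhat K p b) _

theorem symMap_X (e : Gen p b) : symMap K p a b d (X e) =
    SymmetricAlgebra.ι (R K p) (curveIdeal K p a b d) ⟨binom K p a b d e, binom_mem K p a b d e⟩ :=
  aeval_X _ _

/-- The surjection of the free module `𝓜` onto the ideal of the curve. -/
noncomputable def toCurveIdeal (K : Type*) [Field K] (p a b d : ℕ) :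
    M K p b →ₗ[R K p] curveIdeal K p a b d :=
  Finsupp.linearCombination (R K p) fun e => ⟨binom K p a b d e, binom_mem K p a b d e⟩

theorem coe_toCurveIdeal (H : M K p b) : (toCurveIdeal K p a b d H : R K p) =
    Finsupp.linearCombination (R K p) (binom K p a b d) H := by
  rw [toCurveIdeal, ← Submodule.subtype_apply, Finsupp.apply_linearCombination]
  rfl

theorem toCurveIdeal_surjective
    (hspan : Ideal.span (Set.range (binom K p a b d)) = curveIdeal K p a b d) :
    Function.Surjective (toCurveIdeal K p a b d) := by
  rintro ⟨f, hf⟩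
  rw [← hspan] at hf
  obtain ⟨H, rfl⟩ := (Finsupp.mem_span_range_iff_exists_finsupp
    (R := R K p) (v := binom K p a b d)).1 hf
  refine ⟨H, Subtype.ext ?_⟩
  rw [coe_toCurveIdeal, Finsupp.linearCombination_apply]

theorem ker_toCurveIdeal : LinearMap.ker (toCurveIdeal K p a b d) = syzygies K p a b d := by
  ext H
  rw [syzygies, LinearMap.mem_ker, LinearMap.mem_ker, ← coe_toCurveIdeal, Submodule.coe_eq_zero]

theorem symMap_linForm (H : M K p b) : symMap K p a b d (linForm K p b H) =
    SymmetricAlgebra.ι (R K p) (curveIdeal K p a b d) (toCurveIdeal K p a b d H) := by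
  induction H using Finsupp.induction_linear with
  | zero => simp
  | add f g hf hg => rw [map_add, map_add, hf, hg, map_add, map_add]
  | single e f =>
    rw [linForm_single, map_smul, symMap_X, toCurveIdeal, Finsupp.linearCombination_single,
      map_smul]

theorem symMap_surjective
    (hspan : Ideal.span (Set.range (binom K p a b d)) = curveIdeal K p a b d) :
    Function.Surjective (symMap K p a b d) := by
  intro y
  induction y using SymmetricAlgebra.induction with
  | algebraMap r => exact ⟨algebraMap _ _ r, AlgHom.commutes _ _⟩
  | ι f =>
    obtain ⟨H, rfl⟩ := toCurveIdeal_surjective hspan f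
    exact ⟨_, symMap_linForm H⟩
  | mul y z hy hz =>
    obtain ⟨F, rfl⟩ := hy
    obtain ⟨G, rfl⟩ := hz
    exact ⟨F * G, map_mul _ _ _⟩
  | add y z hy hz =>
    obtain ⟨F, rfl⟩ := hy
    obtain ⟨G, rfl⟩ := hz
    exact ⟨F + G, map_add _ _ _⟩

/-- The quotient map `R̂ → R̂ / 𝓛` factors through `symMap`, so nothing outside `𝓛` is killed. The
factorization is the lift to `Sym(℘)` of a linear map on `℘`. -/
theorem ker_symMap (hspan : Ideal.span (Set.range (binom K p a b d)) = curveIdeal K p a b d) :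
    RingHom.ker (symMap K p a b d) = idealL K p a b d := by
  refine le_antisymm (fun F hF => ?_) ?_
  · let q : Rhat K p b →ₐ[R K p] Rhat K p b ⧸ idealL K p a b d := Ideal.Quotient.mkₐ _ _
    have hker : LinearMap.ker (toCurveIdeal K p a b d) ≤
        LinearMap.ker (q.toLinearMap ∘ₗ linForm K p b) := by
      rw [ker_toCurveIdeal]
      intro H hH
      refine Ideal.Quotient.eq_zero_iff_mem.2 (Ideal.subset_span ?_)
      rw [← map_linForm_syzygies]
      exact ⟨H, hH, rfl⟩
    -- `𝓜 → ℘` is onto with kernel `𝓝`, and linear forms from `𝓝` vanish modulo `𝓛`, so the class of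
    -- a linear form depends only on its image in `℘`.
    obtain ⟨g, hg⟩ : ∃ g : curveIdeal K p a b d →ₗ[R K p] Rhat K p b ⧸ idealL K p a b d,
        ∀ H, g (toCurveIdeal K p a b d H) = q (linForm K p b H) := by
      refine ⟨(LinearMap.ker (toCurveIdeal K p a b d)).liftQ _ hker ∘ₗ
        ((toCurveIdeal K p a b d).quotKerEquivOfSurjective
          (toCurveIdeal_surjective hspan)).symm.toLinearMap, fun H => ?_⟩
      have : ((toCurveIdeal K p a b d).quotKerEquivOfSurjective
          (toCurveIdeal_surjective hspan)).symm (toCurveIdeal K p a b d H) =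
          Submodule.Quotient.mk H := by
        rw [LinearEquiv.symm_apply_eq]
        rfl
      simp only [LinearMap.comp_apply, LinearEquiv.coe_coe]
      rw [this]
      rfl
    have hcomp : (SymmetricAlgebra.lift (A := Rhat K p b ⧸ idealL K p a b d) g).comp
        (symMap K p a b d) = q := by
      refine MvPolynomial.algHom_ext fun e => ?_
      have h1 : (X e : Rhat K p b) = linForm K p b (Finsupp.single e 1) := by
        rw [linForm_single, one_smul]
      rw [AlgHom.comp_apply, h1, symMap_linForm, SymmetricAlgebra.lift_ι_apply, hg]
    have h := DFunLike.congr_fun hcomp F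
    have hF0 : symMap K p a b d F = 0 := hF
    rw [AlgHom.comp_apply, hF0, map_zero] at h
    exact Ideal.Quotient.eq_zero_iff_mem.1 h.symm
  · rw [idealL, ← map_linForm_syzygies]
    refine Ideal.span_le.2 ?_
    rintro _ ⟨H, hH, rfl⟩
    have hH0 : toCurveIdeal K p a b d H = 0 := by
      rw [← LinearMap.mem_ker, ker_toCurveIdeal]
      exact hH
    change symMap K p a b d (linForm K p b H) = 0
    rw [symMap_linForm, hH0, map_zero]

end Symmetric

end MonomialCurve

theorem theorem6p2 (K : Type*) [Field K] (p a b d : ℕ) (hp : 2 ≤ p) (ha : 1 ≤ a) (hb : 1 ≤ b)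
    (hbp : b ≤ p) (hd : 1 ≤ d) (hgcd : Nat.gcd (a * p + b) d = 1) :
    -- the binomials generate the ideal of the curve, so `syzygies` is its first syzygy module
    Ideal.span (Set.range (MonomialCurve.binom K p a b d)) = MonomialCurve.curveIdeal K p a b d ∧
    GroebnerModule.IsMonomialOrder (MonomialCurve.gtM p a b d) ∧
    GroebnerModule.IsMinimalGroebnerBasis (MonomialCurve.gtM p a b d)
      (MonomialCurve.syzygies K p a b d) (MonomialCurve.Ghat K p a b d) ∧
    -- the syzygies are the linear relations, and these define the symmetric algebra
    Submodule.map (MonomialCurve.linForm K p b) (MonomialCurve.syzygies K p a b d) =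
      MonomialCurve.linearRelations K p a b d ∧
    MonomialCurve.idealL K p a b d =
      Ideal.span (MonomialCurve.linForm K p b '' MonomialCurve.Ghat K p a b d) ∧
    Function.Surjective (MonomialCurve.symMap K p a b d) ∧
    RingHom.ker (MonomialCurve.symMap K p a b d) = MonomialCurve.idealL K p a b d := by
  have hspan := MonomialCurve.span_binom_eq_curveIdeal (K := K) (by omega : 1 ≤ p) ha hb hbp hgcd
  exact ⟨hspan, MonomialCurve.isMonomialOrder_gtM hb,
    MonomialCurve.isMinimalGroebnerBasis_Ghat ha hb hbp, MonomialCurve.map_linForm_syzygies,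
    MonomialCurve.idealL_eq_span (MonomialCurve.span_Ghat ha hb hbp),
    MonomialCurve.symMap_surjective hspan, MonomialCurve.ker_symMap hspan⟩
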